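/- For integers $d\ge 2$ and $n\ge 1$, let $T_d(n)$ be the finite tree with root $\rho$ in which every vertex has degree $d$, except the vertices at the maximal distance $n$ from the root, which have degree $1$. Fix integers $d\ge 3$ and $b\ge 2$. Let $T_d(n)\times T_b(n)$ be the direct product graph, in which $(x_1,y_1)$ and $(x_2,y_2)$ are adjacent if and only if either $x_1=x_2$ and $y_1,y_2$ are adjacent in $T_b(n)$, or $y_1=y_2$ and $x_1,x_2$ are adjacent in $T_d(n)$. Label the edges of this graph by i.i.d. random variables that are uniform on $[0,1]$, and let $\Gamma_n$ be the corresponding minimal spanning tree, that is, the (almost surely unique) spanning tree of $T_d(n)\times T_b(n)$ with the least sum of edge labels. Let $L_n$ be the sum of the distances in $\Gamma_n$ from $(\rho,\rho)$ to its neighbors in $T_d(n)\times T_b(n)$. Then the random variables $L_n$, $n\ge 1$, are not tight, i.e. $$\sup_{M>1}\ \inf_{n\ge 1}\ \mathbf{P}[L_n\le M]<1 .$$ -/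

import Mathlib

open MeasureTheory ProbabilityTheory

/-- Vertices of the finite tree `T_d(n)`: the words of length at most `n` over an alphabet of `d`
letters in which no two consecutive letters agree. -/
def RegTree (d n : ℕ) : Type :=
  {w : List (Fin d) // w.IsChain (fun a c => a ≠ c) ∧ w.length ≤ n}

namespace RegTree

instance (d n : ℕ) : Finite (RegTree d n) :=
  ((List.finite_length_le (Fin d) n).subset (fun _ h => h.2) :
    Set.Finite {w : List (Fin d) | w.IsChain (fun a c => a ≠ c) ∧ w.length ≤ n}).to_subtype

noncomputable instance (d n : ℕ) : Fintype (RegTree d n) := Fintype.ofFinite _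

/-- The root `ρ` is the empty word. -/
def root (d n : ℕ) : RegTree d n := ⟨[], List.IsChain.nil, Nat.zero_le n⟩

/-- The tree `T_d(n)`: two words are adjacent iff one of them arises from the other by putting one
letter in front of it. See `RegTree.graph_spec`. -/
def graph (d n : ℕ) : SimpleGraph (RegTree d n) where
  Adj v w := (∃ a, w.1 = a :: v.1) ∨ (∃ a, v.1 = a :: w.1)
  symm := ⟨fun _ _ h => h.symm⟩
  loopless := ⟨fun v h => by rcases h with ⟨a, h⟩ | ⟨a, h⟩ <;> simp at h⟩

end RegTree

open Classical in
/-- `Γ` is a minimal spanning tree of the graph `X` on the finite vertex set `V` with edge labels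
`U`: a subgraph of `X` that is a tree on all of `V`, whose sum of labels is least among all such
trees. -/
def IsMinSpanningTree {V : Type*} [Fintype V] (X : SimpleGraph V) (U : X.edgeSet → ℝ)
    (Γ : SimpleGraph V) : Prop :=
  (Γ ≤ X ∧ Γ.IsTree) ∧ ∀ Γ' : SimpleGraph V, Γ' ≤ X → Γ'.IsTree →
    ∑ e : X.edgeSet with e.1 ∈ Γ.edgeSet, U e ≤ ∑ e : X.edgeSet with e.1 ∈ Γ'.edgeSet, U e

open Classical in
/-- The sum of the distances in `Γ` from `o` to the neighbors of `o` in `X`. -/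
noncomputable def neighborDistSum {V : Type*} [Fintype V] (X Γ : SimpleGraph V) (o : V) : ℕ :=
  ∑ v : V with X.Adj o v, Γ.dist o v

/-- The direct product graph `T_d(n) × T_b(n)`: exactly one coordinate moves, along an edge. -/
def treeProd (d b n : ℕ) : SimpleGraph (RegTree d n × RegTree b n) :=
  SimpleGraph.boxProd (RegTree.graph d n) (RegTree.graph b n)

namespace RegTree

theorem exists_parent {d n : ℕ} (w : RegTree d n) (hw : w.1 ≠ []) :
    ∃ v : RegTree d n, v.1 = w.1.tail ∧ (graph d n).Adj v w := by
  obtain ⟨l, hl, hn⟩ := w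
  cases l with
  | nil => exact absurd rfl hw
  | cons a t =>
    refine ⟨⟨t, hl.tail, ?_⟩, rfl, Or.inl ⟨a, rfl⟩⟩
    simp only [List.length_cons] at hn
    omega

theorem exists_walk {d n : ℕ} (k : ℕ) (w : RegTree d n) (hw : w.1.length = k) :
    ∃ p : (graph d n).Walk (root d n) w, p.length = k := by
  induction k generalizing w with
  | zero =>
    have : w = root d n := Subtype.ext (List.length_eq_zero_iff.1 hw)
    subst this
    exact ⟨.nil, rfl⟩
  | succ k ih =>
    obtain ⟨v, hv, hadj⟩ := exists_parent w (by rintro h; simp [h] at hw)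
    obtain ⟨p, hp⟩ := ih v (by simp [hv, hw])
    exact ⟨p.concat hadj, by simp [hp]⟩

theorem connected (d n : ℕ) : (graph d n).Connected := by
  rw [SimpleGraph.connected_iff_exists_forall_reachable]
  exact ⟨root d n, fun w => ⟨(exists_walk _ w rfl).choose⟩⟩

theorem length_le_walk {d n : ℕ} {v w : RegTree d n} (p : (graph d n).Walk v w) :
    w.1.length ≤ v.1.length + p.length := by
  induction p with
  | nil => simp
  | cons h p ih =>
    rw [SimpleGraph.Walk.length_cons]
    rcases h with ⟨a, h⟩ | ⟨a, h⟩
    · rw [h, List.length_cons] at ih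
      omega
    · rw [h, List.length_cons]
      omega

theorem dist_root {d n : ℕ} (w : RegTree d n) : (graph d n).dist (root d n) w = w.1.length := by
  obtain ⟨p, hp⟩ := exists_walk _ w rfl
  obtain ⟨q, hq⟩ := (connected d n).exists_walk_length_eq_dist (root d n) w
  have h1 := SimpleGraph.dist_le p
  have h2 := length_le_walk q
  have h3 : (root d n).1.length = 0 := rfl
  omega

theorem isTree (d n : ℕ) : (graph d n).IsTree := by
  classical
  rw [SimpleGraph.isTree_iff_connected_and_card]
  refine ⟨connected d n, ?_⟩
  have hne : ∀ w : RegTree d n, w ≠ root d n → w.1 ≠ [] := fun w hw h => hw (Subtype.ext h)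
  choose par hpar hadj using fun w : {w : RegTree d n // w ≠ root d n} =>
    exists_parent w.1 (hne w.1 w.2)
  let g : {w : RegTree d n // w ≠ root d n} → (graph d n).edgeSet :=
    fun w => ⟨s(par w, w.1), hadj w⟩
  have hlen : ∀ w, (par w).1.length + 1 = w.1.1.length := by
    intro w
    have := List.length_pos_iff.2 (hne w.1 w.2)
    rw [hpar, List.length_tail]
    omega
  have hg : Function.Bijective g := by
    constructor
    · intro w w' h
      have h' : s(par w, w.1) = s(par w', w'.1) := congrArg Subtype.val h
      rcases Sym2.eq_iff.1 h' with ⟨_, h2⟩ | ⟨h1, h2⟩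
      · exact Subtype.ext h2
      · have e1 := hlen w
        have e2 := hlen w'
        rw [h1] at e1
        rw [← h2] at e2
        omega
    · have key : ∀ v w : RegTree d n, (∃ a, w.1 = a :: v.1) → ∃ x, (g x).1 = s(v, w) := by
        rintro v w ⟨a, h⟩
        have hw : w ≠ root d n := by
          rintro rfl
          simp [root] at h
        refine ⟨⟨w, hw⟩, ?_⟩
        have : par ⟨w, hw⟩ = v := Subtype.ext (by rw [hpar]; simp [h])
        simp only [g, this]
      rintro ⟨e, he⟩
      induction e using Sym2.ind with
      | _ v w =>
        rcases he with h | h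
        · obtain ⟨x, hx⟩ := key v w h
          exact ⟨x, Subtype.ext hx⟩
        · obtain ⟨x, hx⟩ := key w v h
          exact ⟨x, Subtype.ext (hx.trans Sym2.eq_swap)⟩
  rw [← Nat.card_congr (Equiv.ofBijective g hg), Nat.card_eq_fintype_card,
    Nat.card_eq_fintype_card, Fintype.card_subtype_compl, Fintype.card_subtype_eq]
  have : 0 < Fintype.card (RegTree d n) := Fintype.card_pos_iff.2 ⟨root d n⟩
  omega

theorem ncard_neighborSet {d n : ℕ} (v : RegTree d n) (hv : v.1.length < n) :
    ((graph d n).neighborSet v).ncard = d := by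
  classical
  let f : Fin d → List (Fin d) := fun c => if v.1.head? = some c then v.1.tail else c :: v.1
  have hf : Function.Injective f := by
    intro a c h
    obtain ⟨l, hl, hn⟩ := v
    simp only [f] at h
    split_ifs at h with h1 h2 h2
    · exact Option.some.inj (h1.symm.trans h2)
    · have := congrArg List.length h
      simp at this
    · have := congrArg List.length h
      simp at this
      omega
    · exact (List.cons.inj h).1
  have himg : Subtype.val '' ((graph d n).neighborSet v) = Set.range f := by
    ext l
    constructor
    · rintro ⟨w, hw, rfl⟩
      rcases hw with ⟨a, h⟩ | ⟨a, h⟩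
      · refine ⟨a, ?_⟩
        have := w.2.1
        rw [h] at this
        simp only [f]
        rw [if_neg, h]
        intro h0
        cases hv' : v.1 with
        | nil => simp [hv'] at h0
        | cons x t => simp_all
      · exact ⟨a, by simp [f, h]⟩
    · rintro ⟨a, rfl⟩
      by_cases h : v.1.head? = some a
      · obtain ⟨t, ht⟩ : ∃ t, v.1 = a :: t := by
          cases hv' : v.1 with
          | nil => simp [hv'] at h
          | cons x t => simp_all
        obtain ⟨w, hw, hadj⟩ := exists_parent v (by simp [ht])
        exact ⟨w, hadj.symm, by simp [f, hw, h]⟩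
      · refine ⟨⟨a :: v.1, ?_, by simpa using hv⟩, Or.inl ⟨a, rfl⟩, by simp [f, h]⟩
        obtain ⟨l, hl, hn⟩ := v
        cases l <;> simp_all
        exact fun h' => h h'.symm
  rw [← Set.ncard_image_of_injective ((graph d n).neighborSet v) Subtype.val_injective]
  erw [himg]
  rw [ ← Set.image_univ,
    Set.ncard_image_of_injective _ hf, Set.ncard_univ, Nat.card_eq_fintype_card, Fintype.card_fin]

theorem ncard_neighborSet_leaf {d n : ℕ} (hn : 1 ≤ n) (v : RegTree d n) (hv : v.1.length = n) :
    ((graph d n).neighborSet v).ncard = 1 := by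
  obtain ⟨w, hw, hadj⟩ := exists_parent v (by rintro h; simp [h] at hv; omega)
  rw [Set.ncard_eq_one]
  refine ⟨w, Set.eq_singleton_iff_unique_mem.2 ⟨hadj.symm, ?_⟩⟩
  rintro u (⟨a, h⟩ | ⟨a, h⟩)
  · have := u.2.2
    simp [h] at this
    omega
  · exact Subtype.ext (by simp [hw, h])

/-- `graph d n` is the rooted tree it should be: it is a tree, every vertex has distance at most
`n` from the root, those at distance less than `n` have degree `d`, and those at distance `n`
have degree `1` (if `n ≥ 1`). -/
theorem graph_spec (d n : ℕ) :
    (graph d n).IsTree ∧ ∀ v : RegTree d n,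
      (graph d n).dist (root d n) v ≤ n ∧
      ((graph d n).dist (root d n) v < n → ((graph d n).neighborSet v).ncard = d) ∧
      ((graph d n).dist (root d n) v = n → 1 ≤ n → ((graph d n).neighborSet v).ncard = 1) := by
  refine ⟨isTree d n, fun v => ?_⟩
  rw [dist_root]
  exact ⟨v.2.2, ncard_neighborSet v, fun h hn => ncard_neighborSet_leaf hn v h⟩

end RegTree

/-- Every connected finite graph has a minimal spanning tree, whatever the labels are. -/
theorem exists_isMinSpanningTree {V : Type*} [Fintype V] (X : SimpleGraph V) (hX : X.Connected)
    (U : X.edgeSet → ℝ) : ∃ Γ, IsMinSpanningTree X U Γ := by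
  classical
  obtain ⟨T, hT, hT'⟩ := hX.exists_isTree_le
  obtain ⟨Γ, hΓ, hmin⟩ := Set.exists_min_image {Γ : SimpleGraph V | Γ ≤ X ∧ Γ.IsTree}
    (fun Γ => ∑ e : X.edgeSet with e.1 ∈ Γ.edgeSet, U e) (Set.toFinite _) ⟨T, hT, hT'⟩
  refine ⟨Γ, hΓ, fun Γ' h1 h2 => ?_⟩
  convert hmin Γ' ⟨h1, h2⟩

theorem treeProd_connected (d b n : ℕ) : (treeProd d b n).Connected :=
  (RegTree.connected d n).boxProd (RegTree.connected b n)

/-! The proof is a finite form of a cost argument: a product of two infinite groups has cost 1, and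
a treeing of cost 1 is hyperfinite, which contradicts nonamenability. Suppose the distances are
tight. Deleting every edge that is the strict maximum of a cycle of length at most `R + 1` leaves a
local forest containing the minimal spanning tree, for every `R`
(`IsMinSpanningTree.le_localForest`). Hence, with probability near 1 and uniformly in `n` and `R`,
the root is joined to its neighbors by bounded walks in the local forest. This event depends only on
a bounded neighborhood, so it can be moved to a finite graph `G`, a product of Schreier graphs that
looks like the product of trees at each vertex (`pi_unif_badLabels_le`). There, outside a sparse bad
set, the local forest `F` of `G` joins neighbors by bounded walks. Let `N` be the number of vertices
of `G`. A subgraph `H` with little more than `N` edges replaces each edge of `G` by a bounded walk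
(`sparseSubgraph_near`). As `F` has no short cycles, linear algebra over `ZMod 2` shows that `F` has
hardly more edges than `H` (`ncard_edgeSet_le`). Since `F` also has few components, it is nearly
acyclic, and deleting few edges cuts it into parts of bounded radius (`exists_partition`). A pair of
`G`-neighbors in different parts starts at a bad vertex or near a deleted edge, so such pairs are
few (`card_le_of_partition`). But small sets in `G` expand because `d ≥ 3`
(`schreierProd_boundary`). The two estimates conflict in `false_of_counts`. -/

namespace SimpleGraph

/-! ### Short walks, local forests and cycles modulo 2 -/

variable {V : Type*}

/-- `x` and `y` are joined in `X` by a walk of length at most `L`. -/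
def Near (X : SimpleGraph V) (L : ℕ) (x y : V) : Prop := ∃ p : X.Walk x y, p.length ≤ L

namespace Near

variable {X Y : SimpleGraph V} {L K : ℕ} {x y z : V}

theorem refl (X : SimpleGraph V) (x : V) : X.Near 0 x x := ⟨.nil, le_rfl⟩

theorem symm (h : X.Near L x y) : X.Near L y x := by
  obtain ⟨p, hp⟩ := h
  exact ⟨p.reverse, by simpa using hp⟩

theorem trans (h : X.Near L x y) (h' : X.Near K y z) : X.Near (L + K) x z := by
  obtain ⟨p, hp⟩ := h
  obtain ⟨q, hq⟩ := h'
  exact ⟨p.append q, by rw [Walk.length_append]; omega⟩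

theorem mono (h : X.Near L x y) (hL : L ≤ K) : X.Near K x y := by
  obtain ⟨p, hp⟩ := h
  exact ⟨p, hp.trans hL⟩

theorem mono_graph (h : X.Near L x y) (hX : X ≤ Y) : Y.Near L x y := by
  obtain ⟨p, hp⟩ := h
  exact ⟨p.mapLe hX, by simpa using hp⟩

theorem of_adj (h : X.Adj x y) : X.Near 1 x y := ⟨h.toWalk, by simp⟩

theorem reachable (h : X.Near L x y) : X.Reachable x y := ⟨h.choose⟩

end Near

/-- In a graph with degrees at most `D` at most `(D + 1) ^ L` vertices are within distance `L`. -/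
theorem card_near_le [Fintype V] [DecidableEq V] (X : SimpleGraph V) (D : ℕ)
    (hD : ∀ x, ∃ s : Finset V, s.card ≤ D ∧ ∀ y, X.Adj x y → y ∈ s) (L : ℕ) (x : V) :
    ∃ s : Finset V, s.card ≤ (D + 1) ^ L ∧ ∀ y, X.Near L x y → y ∈ s := by
  induction L generalizing x with
  | zero =>
    refine ⟨{x}, by simp, ?_⟩
    rintro y ⟨p, hp⟩
    have := p.eq_of_length_eq_zero (by omega)
    simp [this]
  | succ L ih =>
    choose t ht ht' using ih
    obtain ⟨s, hs, hs'⟩ := hD x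
    refine ⟨(insert x s).biUnion t, ?_, ?_⟩
    · calc _ ≤ (insert x s).card * (D + 1) ^ L := Finset.card_biUnion_le_card_mul _ _ _
            fun a _ => ht a
        _ ≤ (D + 1) * (D + 1) ^ L := by
            gcongr
            exact (Finset.card_insert_le _ _).trans (by omega)
        _ = _ := by ring
    · rintro y ⟨p, hp⟩
      rw [Finset.mem_biUnion]
      cases p with
      | nil => exact ⟨x, by simp, ht' x x ⟨.nil, by simp⟩⟩
      | @cons _ v _ h q =>
        refine ⟨v, by simp [hs' v h], ht' v y ⟨q, ?_⟩⟩
        rw [Walk.length_cons] at hp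
        omega

/-- The edges of `X` whose end points are not joined by a walk of length at most `R` along which
all labels are smaller. -/
def localForest (X : SimpleGraph V) (W : Sym2 V → ℝ) (R : ℕ) : SimpleGraph V where
  Adj x y := X.Adj x y ∧ ∀ p : X.Walk x y, p.length ≤ R → ∃ f ∈ p.edges, W s(x, y) ≤ W f
  symm := ⟨fun x y ⟨h, h'⟩ => ⟨h.symm, fun p hp => by
    obtain ⟨f, hf, hf'⟩ := h' p.reverse (by simpa using hp)
    exact ⟨f, by simpa using hf, by rwa [Sym2.eq_swap]⟩⟩⟩
  loopless := ⟨fun x h => X.loopless.irrefl x h.1⟩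

theorem localForest_le (X : SimpleGraph V) (W : Sym2 V → ℝ) (R : ℕ) : X.localForest W R ≤ X :=
  fun _ _ h => h.1

/-- A closed walk in a forest uses every edge an even number of times. -/
theorem IsAcyclic.even_count_edges [DecidableEq V] {T : SimpleGraph V} (hT : T.IsAcyclic) {x : V}
    (p : T.Walk x x) (e : Sym2 V) : Even (p.edges.count e) := by
  classical
  by_cases he : e ∈ T.edgeSet
  swap
  · rw [List.count_eq_zero_of_not_mem fun h => he (p.edges_subset_edgeSet h)]
    exact Even.zero
  induction e using Sym2.ind with
  | _ a b =>
  have hb : T.IsBridge s(a, b) := isAcyclic_iff_forall_isBridge.1 hT he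
  rw [isBridge_iff] at hb
  set Y := T.deleteEdges {s(a, b)} with hY
  -- Each edge `ab` of a forest is a bridge. The parity of the crossings of `ab` records whether a
  -- walk ends on the side where it began.
  let f : V → Bool := fun v => decide (Y.Reachable a v)
  have key : ∀ (u v : V) (q : T.Walk u v), Even (q.edges.count s(a, b)) ↔ f u = f v := by
    intro u v q
    induction q with
    | nil => simp
    | @cons u w v h q ih =>
      rw [Walk.edges_cons, List.count_cons]
      by_cases hh : s(u, w) = s(a, b)
      · have h1 : f u ≠ f w := by
          rcases Sym2.eq_iff.1 hh with ⟨rfl, rfl⟩ | ⟨rfl, rfl⟩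
          · simp [f, hb]
          · simp [f, hb]
        simp only [hh, beq_self_eq_true, if_true, Nat.even_add_one]
        rw [ih]
        cases hu : f u <;> cases hw : f w <;> cases hv : f v <;> simp_all
      · have h1 : f u = f w := by
          have hadj : Y.Adj u w := by
            rw [hY, deleteEdges_adj]
            exact ⟨h, hh⟩
          simp only [f, decide_eq_decide]
          exact ⟨fun h => h.trans hadj.reachable, fun h => h.trans hadj.symm.reachable⟩
        simp [hh, ih, h1]
  exact (key x x p).2 rfl

/-- Around a cycle there is a detour avoiding any given edge of it. -/
theorem Walk.IsCycle.exists_detour {T : SimpleGraph V} {u : V} {c : T.Walk u u} (hc : c.IsCycle)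
    {a b : V} (hab : s(a, b) ∈ c.edges) :
    ∃ w : T.Walk a b, w.length < c.length ∧ ∀ f ∈ w.edges, f ∈ c.edges ∧ f ≠ s(a, b) := by
  classical
  -- In the graph formed by the edges of `c` alone, any path from `a` to `b` missing `ab` uses a
  -- proper subset of these edges, which bounds its length.
  let C : SimpleGraph V := fromEdgeSet {e | e ∈ c.edges}
  have hmem : ∀ f ∈ c.edges, f ∈ C.edgeSet := by
    intro f hf
    rw [edgeSet_fromEdgeSet]
    exact ⟨hf, T.not_isDiag_of_mem_edgeSet (c.edges_subset_edgeSet hf)⟩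
  obtain ⟨-, ⟨w⟩⟩ := adj_and_reachable_delete_edges_iff_exists_cycle.2
    ⟨u, c.transfer C hmem, hc.transfer hmem, by rwa [Walk.edges_transfer]⟩
  have hw : ∀ f ∈ w.toPath.1.edges, f ∈ c.edges ∧ f ≠ s(a, b) := by
    intro f hf
    have := w.toPath.1.edges_subset_edgeSet hf
    rw [edgeSet_deleteEdges, edgeSet_fromEdgeSet] at this
    exact ⟨this.1.1, this.2⟩
  refine ⟨w.toPath.1.transfer T fun f hf => c.edges_subset_edgeSet (hw f hf).1, ?_, ?_⟩
  · rw [Walk.length_transfer, ← Walk.length_edges, ← Walk.length_edges c,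
      ← List.toFinset_card_of_nodup w.toPath.2.isTrail.edges_nodup,
      ← List.toFinset_card_of_nodup hc.isTrail.edges_nodup]
    refine Finset.card_lt_card ⟨fun f hf => ?_, fun h => ?_⟩
    · exact List.mem_toFinset.2 (hw f (List.mem_toFinset.1 hf)).1
    · exact (hw _ (List.mem_toFinset.1 (h (List.mem_toFinset.2 hab)))).2 rfl
  · simpa using hw

/-- If the labels are distinct, short closed walks in the local forest are null-homologous
mod `2`. -/
theorem even_count_edges_localForest [DecidableEq V] (X : SimpleGraph V) {W : Sym2 V → ℝ}
    (hW : Function.Injective W) (R : ℕ) {x : V} (p : (X.localForest W R).Walk x x)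
    (hp : p.length ≤ R + 1) (e : Sym2 V) : Even (p.edges.count e) := by
  classical
  -- The edges of `p` form a forest: a cycle among them has length at most `R + 1`, so its heaviest
  -- edge has a detour of length at most `R` with smaller labels, which the local forest forbids.
  let T : SimpleGraph V := fromEdgeSet {e | e ∈ p.edges}
  have hTF : T ≤ X.localForest W R := by
    intro u v h
    rw [fromEdgeSet_adj] at h
    exact p.edges_subset_edgeSet h.1
  have hTac : T.IsAcyclic := by
    intro u c hc
    obtain ⟨g, hg, hmax⟩ := Finset.exists_max_image c.edges.toFinset W (by
      cases c with
      | nil => exact absurd rfl hc.ne_nil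
      | cons h q => exact ⟨_, List.mem_toFinset.2 (List.mem_cons_self ..)⟩)
    rw [List.mem_toFinset] at hg
    induction g using Sym2.ind with
    | _ a b =>
    have hlen : c.length ≤ R + 1 := by
      rw [← Walk.length_edges, ← List.toFinset_card_of_nodup hc.isTrail.edges_nodup]
      refine (Finset.card_le_card (t := p.edges.toFinset) fun f hf => ?_).trans
        ((List.toFinset_card_le _).trans (by simpa using hp))
      have := c.edges_subset_edgeSet (List.mem_toFinset.1 hf)
      rw [edgeSet_fromEdgeSet] at this
      exact List.mem_toFinset.2 this.1
    obtain ⟨w, hw, hw'⟩ := hc.exists_detour hg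
    have hadj : (X.localForest W R).Adj a b := hTF (c.edges_subset_edgeSet hg)
    obtain ⟨f, hf, hf'⟩ := hadj.2 (w.mapLe (hTF.trans (localForest_le ..)))
      (by rw [Walk.length_mapLe]; omega)
    obtain ⟨h1, h2⟩ := hw' f (by simpa using hf)
    exact h2 (hW (le_antisymm (hmax f (List.mem_toFinset.2 h1)) hf'))
  have hmem : ∀ f ∈ p.edges, f ∈ T.edgeSet := by
    intro f hf
    rw [edgeSet_fromEdgeSet]
    exact ⟨hf, (X.localForest W R).not_isDiag_of_mem_edgeSet (p.edges_subset_edgeSet hf)⟩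
  have := hTac.even_count_edges (p.transfer T hmem) e
  rwa [Walk.edges_transfer] at this

/-- A walk from inside to outside a set has a step leaving the set. -/
theorem Walk.exists_exit {X : SimpleGraph V} (S : V → Prop) {x y : V} (p : X.Walk x y) (hx : S x)
    (hy : ¬ S y) : ∃ u v, s(u, v) ∈ p.edges ∧ S u ∧ ¬ S v := by
  induction p with
  | nil => exact absurd hx hy
  | @cons u v w h q ih =>
    by_cases hv : S v
    · obtain ⟨a, b, hab, h'⟩ := ih hv hy
      exact ⟨a, b, by simp [hab], h'⟩
    · exact ⟨u, v, by simp, hx, hv⟩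

end SimpleGraph

/-! ### The exchange argument for minimal spanning trees -/

open SimpleGraph

/-- A minimal spanning tree has no edge which is the unique maximum of a cycle. -/
theorem IsMinSpanningTree.le_localForest {V : Type*} [Fintype V] {X Γ : SimpleGraph V}
    {W : Sym2 V → ℝ} {U : X.edgeSet → ℝ} (hUW : ∀ e, U e = W e.1)
    (h : IsMinSpanningTree X U Γ) (R : ℕ) : Γ ≤ X.localForest W R := by
  classical
  obtain ⟨⟨hΓX, hΓT⟩, hmin⟩ := h
  intro x y hxy
  refine ⟨hΓX hxy, fun p _ => ?_⟩
  by_contra! hp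
  have hb : Γ.IsBridge s(x, y) := isAcyclic_iff_forall_isBridge.1 hΓT.isAcyclic hxy
  rw [isBridge_iff] at hb
  -- If all labels on `p` were below that of `xy`, then `p` would cross between the two components
  -- of `Γ` minus `xy` at some edge `uv`, and trading `xy` for `uv` would give a cheaper spanning
  -- tree.
  set Y := Γ.deleteEdges {s(x, y)} with hY
  obtain ⟨u, v, huv, hu, hv⟩ := p.exists_exit (fun z => Y.Reachable x z) (Reachable.refl x) hb
  have hXuv : X.Adj u v := p.edges_subset_edgeSet huv
  have hYΓ : Y ≤ Γ := deleteEdges_le _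
  have hnr : ¬ Y.Reachable u v := fun h' => hv (hu.trans h')
  set Γ' := Y ⊔ edge u v with hΓ'
  have hac : Γ'.IsAcyclic := IsAcyclic.sup_edge_of_not_reachable hnr
    (hΓT.isAcyclic.anti hYΓ)
  have hle : Γ' ≤ X := sup_le (hYΓ.trans hΓX) (by
    intro a b hab
    rw [edge_adj] at hab
    rcases hab.1 with ⟨rfl, rfl⟩ | ⟨rfl, rfl⟩
    exacts [hXuv, hXuv.symm])
  have hreach : ∀ z, Y.Reachable x z ∨ Y.Reachable y z := by
    intro z
    obtain ⟨q⟩ := hΓT.connected.preconnected x z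
    clear hp huv hu hv
    by_contra! hz
    obtain ⟨a, b, hab, ha, hb'⟩ := q.exists_exit (fun z => Y.Reachable x z ∨ Y.Reachable y z)
      (Or.inl (Reachable.refl x)) (by push Not; exact hz)
    push Not at hb'
    have hΓab : Γ.Adj a b := q.edges_subset_edgeSet hab
    by_cases he : s(a, b) = s(x, y)
    · rcases Sym2.eq_iff.1 he with ⟨rfl, rfl⟩ | ⟨rfl, rfl⟩
      · exact hb'.2 (Reachable.refl _)
      · exact hb'.1 (Reachable.refl _)
    · have : Y.Adj a b := by
        rw [hY, deleteEdges_adj]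
        exact ⟨hΓab, he⟩
      rcases ha with ha | ha
      · exact hb'.1 (ha.trans this.reachable)
      · exact hb'.2 (ha.trans this.reachable)
  have huv' : Γ'.Adj u v := Or.inr (by rw [edge_adj]; exact ⟨Or.inl ⟨rfl, rfl⟩, hXuv.ne⟩)
  have hYΓ' : Y ≤ Γ' := le_sup_left
  have hxz : ∀ z, Γ'.Reachable x z := by
    have hxy' : Γ'.Reachable x y := by
      rcases hreach v with h' | h'
      · exact absurd h' hv
      · exact (hu.mono hYΓ').trans (huv'.reachable.trans (h'.mono hYΓ').symm)
    intro z
    rcases hreach z with h' | h'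
    · exact h'.mono hYΓ'
    · exact hxy'.trans (h'.mono hYΓ')
  have htree : Γ'.IsTree := by
    refine ⟨?_, hac⟩
    rw [connected_iff_exists_forall_reachable]
    exact ⟨x, hxz⟩
  have key : ∑ e ∈ Finset.univ.filter fun e : X.edgeSet => e.1 ∈ Γ.edgeSet, U e ≤
      ∑ e ∈ Finset.univ.filter fun e : X.edgeSet => e.1 ∈ Γ'.edgeSet, U e := by
    convert hmin Γ' hle htree
  have hlt : W s(u, v) < W s(x, y) := hp _ huv
  have e1 : (Finset.univ.filter fun e : X.edgeSet => e.1 ∈ Γ.edgeSet) =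
      insert ⟨s(x, y), hΓX hxy⟩ (Finset.univ.filter fun e : X.edgeSet => e.1 ∈ Y.edgeSet) := by
    ext ⟨e, he⟩
    simp only [Finset.mem_filter, Finset.mem_univ, true_and, Finset.mem_insert, hY,
      edgeSet_deleteEdges, Set.mem_sdiff, Set.mem_singleton_iff]
    rw [Subtype.ext_iff]
    constructor
    · intro h'
      by_cases h'' : e = s(x, y) <;> simp [h', h'']
    · rintro (rfl | h')
      exacts [hxy, h'.1]
  have e2 : (Finset.univ.filter fun e : X.edgeSet => e.1 ∈ Γ'.edgeSet) =
      insert ⟨s(u, v), hXuv⟩ (Finset.univ.filter fun e : X.edgeSet => e.1 ∈ Y.edgeSet) := by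
    ext ⟨e, he⟩
    simp only [Finset.mem_filter, Finset.mem_univ, true_and, Finset.mem_insert, hΓ',
      edgeSet_sup, Set.mem_union, edgeSet_edge_of_ne hXuv.ne, Set.mem_singleton_iff]
    rw [Subtype.ext_iff]
    tauto
  rw [e1, e2, Finset.sum_insert, Finset.sum_insert, hUW, hUW] at key
  · linarith
  · simp only [Finset.mem_filter, Finset.mem_univ, true_and]
    exact fun h' => hnr (Adj.reachable h')
  · simp [hY]

/-! ### Counting edges, components and parts of a finite graph -/

namespace SimpleGraph

variable {V : Type*}

/-- The sum modulo `2` of the edges of a walk. -/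
noncomputable def Walk.chain {X : SimpleGraph V} {x y : V} (p : X.Walk x y) : Sym2 V → ZMod 2 :=
  open Classical in fun e => (p.edges.count e : ℕ)

theorem Walk.chain_reverse {X : SimpleGraph V} {x y : V} (p : X.Walk x y) :
    p.reverse.chain = p.chain := by
  funext e
  simp [chain]

theorem Walk.chain_append {X : SimpleGraph V} {x y z : V} (p : X.Walk x y) (q : X.Walk y z) :
    (p.append q).chain = p.chain + q.chain := by
  funext e
  simp [chain]

/-- A graph `F` with no short cycles, whose edges are replaceable by short walks in `H`, which in
turn are replaceable by short walks in `F` outside a bad set, has hardly more edges than `H`. -/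
theorem ncard_edgeSet_le [Fintype V] [DecidableEq V] {G F H : SimpleGraph V} (hFG : F ≤ G)
    (hHG : H ≤ G) {D : ℕ} (hD : ∀ x, ∃ s : Finset V, s.card ≤ D ∧ ∀ y, G.Adj x y → y ∈ s)
    {R : ℕ} (hcyc : ∀ (x : V) (p : F.Walk x x), p.length ≤ R + 1 → p.chain = 0)
    {Bad : Finset V} {M K : ℕ} (hBad : ∀ x ∉ Bad, ∀ y, G.Adj x y → F.Near M x y)
    (hH : ∀ x y, G.Adj x y → H.Near K x y) (hR : K * M ≤ R) :
    F.edgeSet.ncard ≤ H.edgeSet.ncard + Bad.card * ((D + 1) ^ K * D) := by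
  classical
  choose nb hnb hnb' using hD
  choose ball hball hball' using fun x => G.card_near_le D (fun x => ⟨nb x, hnb x, hnb' x⟩) K x
  -- `I` collects the edges of `F` whose replacement in `H` avoids `Bad`. Every other edge of `F`
  -- has an end within distance `K` of `Bad` and so belongs to `J`.
  let I : Set (Sym2 V) := {e | e ∈ F.edgeSet ∧ ∃ (x y : V) (q : H.Walk x y), e = s(x, y) ∧
    q.length ≤ K ∧ ∀ u ∈ q.support, u ∉ Bad}
  let J : Finset (Sym2 V) := Bad.biUnion fun u => (ball u).biUnion fun x => (nb x).image
    fun y => s(x, y)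
  have hJ : J.card ≤ Bad.card * ((D + 1) ^ K * D) := by
    refine Finset.card_biUnion_le_card_mul _ _ _ fun u _ => ?_
    refine (Finset.card_biUnion_le_card_mul _ _ D fun x _ => ?_).trans (by gcongr; exact hball u)
    exact Finset.card_image_le.trans (hnb x)
  have hsub : F.edgeSet ⊆ I ∪ (J : Set (Sym2 V)) := by
    intro e he
    by_contra hne
    rw [Set.mem_union] at hne
    push Not at hne
    induction e using Sym2.ind with
    | _ x y =>
    obtain ⟨q, hq⟩ := hH x y (hFG he)
    have : ∃ u ∈ q.support, u ∈ Bad := by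
      by_contra! h
      exact hne.1 ⟨he, x, y, q, rfl, hq, h⟩
    obtain ⟨u, hu, huB⟩ := this
    apply hne.2
    have hux : G.Near K u x := by
      refine (Near.mono_graph (X := H) ?_ hHG).symm
      exact ⟨q.takeUntil u hu, (q.length_takeUntil_le_length hu).trans hq⟩
    simp only [J, Finset.coe_biUnion, Set.mem_iUnion, Finset.coe_image]
    exact ⟨u, huB, x, hball' u x hux, y, hnb' x y (hFG he), rfl⟩
  -- One chain per edge of `H`, serving both orientations; the value 0 is a dummy when the condition
  -- is vacuous.
  have hc : ∀ f : H.edgeSet, ∃ c : Sym2 V → ZMod 2, ∀ u v, f.1 = s(u, v) → u ∉ Bad → v ∉ Bad →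
      ∃ p : F.Walk u v, p.length ≤ M ∧ p.chain = c := by
    rintro ⟨f, hf⟩
    induction f using Sym2.ind with
    | _ a b =>
    by_cases ha : a ∈ Bad
    · refine ⟨0, fun u v h hu hv => ?_⟩
      rcases Sym2.eq_iff.1 h with ⟨rfl, rfl⟩ | ⟨rfl, rfl⟩
      exacts [absurd ha hu, absurd ha hv]
    · obtain ⟨p, hp⟩ := hBad a ha b (hHG hf)
      refine ⟨p.chain, fun u v h hu hv => ?_⟩
      rcases Sym2.eq_iff.1 h with ⟨rfl, rfl⟩ | ⟨rfl, rfl⟩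
      · exact ⟨p, hp, rfl⟩
      · exact ⟨p.reverse, by simpa using hp, p.chain_reverse⟩
  choose c hc using hc
  let S := Submodule.span (ZMod 2) (Set.range c)
  have hwalk : ∀ (x y : V) (q : H.Walk x y), (∀ u ∈ q.support, u ∉ Bad) →
      ∃ r : F.Walk x y, r.length ≤ q.length * M ∧ r.chain ∈ S := by
    intro x y q
    induction q with
    | nil => exact fun _ => ⟨.nil, by simp, by
        convert S.zero_mem
        funext e
        simp [Walk.chain]⟩
    | @cons x v y h q ih =>
      intro hq
      obtain ⟨r, hr, hr'⟩ := ih fun u hu => hq u (by simp [hu])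
      obtain ⟨p, hp, hp'⟩ := hc ⟨s(x, v), h⟩ x v rfl (hq x (by simp)) (hq v (by simp))
      refine ⟨p.append r, ?_, ?_⟩
      · rw [Walk.length_append, Walk.length_cons]
        linarith
      · rw [Walk.chain_append, hp']
        exact S.add_mem (Submodule.subset_span ⟨_, rfl⟩) hr'
  -- Closing the replacement walk by `e` itself gives a closed walk in `F` of length at most `K * M
  -- + 1`, whose chain vanishes. So `e` is a sum of vectors `c f`, and the independent vectors of
  -- `I` lie in a space spanned by one vector per edge of `H`.
  have hsingle : ∀ e ∈ I, (Pi.single e 1 : Sym2 V → ZMod 2) ∈ S := by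
    rintro _ ⟨he, x, y, q, rfl, hq, hqB⟩
    obtain ⟨r, hr, hr'⟩ := hwalk x y q hqB
    have hadj : F.Adj x y := he
    have h0 := hcyc x (r.append hadj.symm.toWalk) (by
      rw [Walk.length_append]
      have : q.length * M ≤ K * M := by gcongr
      simp
      omega)
    rw [Walk.chain_append] at h0
    have h1 : hadj.symm.toWalk.chain = Pi.single s(x, y) 1 := by
      funext f
      simp only [Walk.chain, Pi.single_apply, Walk.edges_cons, Walk.edges_nil,
        List.count_singleton]
      rw [Sym2.eq_swap]
      by_cases hf : s(x, y) = f
      · simp [hf]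
      · simp [hf, Ne.symm hf]
    rw [h1] at h0
    have : (Pi.single s(x, y) 1 : Sym2 V → ZMod 2) = r.chain := by
      have h2 := eq_neg_of_add_eq_zero_right h0
      rw [h2]
      funext f
      simp [ZMod.neg_eq_self_mod_two]
    rwa [this]
  have hI : I.ncard ≤ H.edgeSet.ncard := by
    let v : I → Sym2 V → ZMod 2 := fun e => Pi.single e.1 1
    have hv : LinearIndependent (ZMod 2) v := by
      have := (Pi.basisFun (ZMod 2) (Sym2 V)).linearIndependent.comp (Subtype.val : I → Sym2 V)
        Subtype.val_injective
      convert this using 1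
      funext e
      simp [v]
    calc I.ncard = Fintype.card I := by rw [← Nat.card_coe_set_eq, Nat.card_eq_fintype_card]
      _ = Module.finrank (ZMod 2) (Submodule.span (ZMod 2) (Set.range v)) :=
          (finrank_span_eq_card hv).symm
      _ ≤ Module.finrank (ZMod 2) S := by
          apply Submodule.finrank_mono
          rw [Submodule.span_le]
          rintro _ ⟨e, rfl⟩
          exact hsingle e.1 e.2
      _ ≤ Fintype.card H.edgeSet := finrank_range_le_card c
      _ = H.edgeSet.ncard := by rw [← Nat.card_coe_set_eq, Nat.card_eq_fintype_card]
  calc F.edgeSet.ncard ≤ (I ∪ (J : Set (Sym2 V))).ncard := Set.ncard_le_ncard hsub (Set.toFinite _)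
    _ ≤ I.ncard + (J : Set (Sym2 V)).ncard := Set.ncard_union_le _ _
    _ ≤ _ := by
      rw [Set.ncard_coe_finset]
      omega

/-- A vertex at positive distance from the chosen vertex of its component has a neighbor which
is nearer. -/
theorem exists_adj_dist_out {F : SimpleGraph V} (v : V)
    (hv : F.dist v (F.connectedComponentMk v).out ≠ 0) :
    ∃ u, F.Adj v u ∧ F.dist u (F.connectedComponentMk u).out + 1 =
      F.dist v (F.connectedComponentMk v).out := by
  have hr : F.Reachable v (F.connectedComponentMk v).out :=
    ConnectedComponent.exact (Quot.out_eq _).symm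
  obtain ⟨p, hp⟩ := hr.exists_walk_length_eq_dist
  generalize hw : (F.connectedComponentMk v).out = w at *
  cases p with
  | nil => simp at hv
  | @cons _ u _ h q =>
    refine ⟨u, h, ?_⟩
    rw [← ConnectedComponent.connectedComponentMk_eq_of_adj h, hw]
    rw [Walk.length_cons] at hp
    have h1 := dist_le q
    obtain ⟨q', hq'⟩ := q.reachable.exists_walk_length_eq_dist
    have h2 := dist_le (Walk.cons h q')
    rw [Walk.length_cons] at h2
    omega

/-- A finite graph with few independent cycles falls into parts of bounded radius after deletion
of few edges. -/
theorem exists_partition [Fintype V] (F : SimpleGraph V) {k : ℕ} (hk : 0 < k) :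
    ∃ (rep : V → V) (Del : Finset (Sym2 V)), (∀ v, F.Near k v (rep v)) ∧
      (∀ x y, F.Adj x y → s(x, y) ∉ Del → rep x = rep y) ∧
      k * Del.card + k * Fintype.card V ≤
        k * F.edgeSet.ncard + k * Nat.card F.ConnectedComponent + Fintype.card V := by
  classical
  let dep : V → ℕ := fun v => F.dist v (F.connectedComponentMk v).out
  have hpar : ∀ v, ∃ u, (dep v ≠ 0 → F.Adj v u ∧ dep u + 1 = dep v) ∧ (dep v = 0 → u = v) := by
    intro v
    by_cases hv : dep v = 0
    · exact ⟨v, fun h => absurd hv h, fun _ => rfl⟩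
    · obtain ⟨u, hu⟩ := exists_adj_dist_out v hv
      exact ⟨u, fun _ => hu, fun h => absurd h hv⟩
  choose p hp hp0 using hpar
  let NR : Finset V := Finset.univ.filter fun v => dep v ≠ 0
  have hNR : Fintype.card V ≤ NR.card + Nat.card F.ConnectedComponent := by
    have h1 : (Finset.univ.filter fun v => dep v = 0).card ≤ Nat.card F.ConnectedComponent := by
      rw [Nat.card_eq_fintype_card, ← Finset.card_univ]
      refine Finset.card_le_card_of_injOn F.connectedComponentMk (by simp) ?_
      intro v hv w hw h
      have key : ∀ v, dep v = 0 → v = (F.connectedComponentMk v).out := by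
        intro v hv
        exact (Reachable.dist_eq_zero_iff (ConnectedComponent.exact (Quot.out_eq _).symm)).1 hv
      simp only [Finset.coe_filter, Finset.mem_univ, true_and, Set.mem_ofPred_eq] at hv hw
      rw [key v hv, key w hw, h]
    have h2 := Finset.card_filter_add_card_filter_not (s := (Finset.univ : Finset V))
      (fun v => dep v = 0)
    have h3 : NR.card = (Finset.univ.filter fun v => ¬ dep v = 0).card := by
      congr 1
    rw [Finset.card_univ] at h2
    omega
  -- The parent edges form a spanning forest, with one edge for each vertex of positive depth.
  let T : Finset (Sym2 V) := NR.image fun v => s(v, p v)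
  have hT : T.card = NR.card := by
    refine Finset.card_image_of_injOn ?_
    intro v hv w hw h
    simp only [NR, Finset.coe_filter, Finset.mem_univ, true_and, Set.mem_ofPred_eq] at hv hw
    rcases Sym2.eq_iff.1 h with ⟨h, _⟩ | ⟨h1, h2⟩
    · exact h
    · have e1 := (hp v hv).2
      have e2 := (hp w hw).2
      rw [h2] at e1
      rw [← h1] at e2
      omega
  have hTF : T ⊆ F.edgeFinset := by
    intro e he
    obtain ⟨v, hv, rfl⟩ := Finset.mem_image.1 he
    rw [mem_edgeFinset]
    exact (hp v (Finset.mem_filter.1 hv).2).1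
  -- Pigeonhole over the `k` residue classes of the depth: the sparsest class has at most a fraction
  -- `1 / k` of the vertices.
  have hcut : ∃ j ∈ Finset.range k, k * (Finset.univ.filter fun v => (dep v + j) % k = 0).card ≤
      Fintype.card V := by
    by_contra! h
    have h1 : ∑ j ∈ Finset.range k, (Finset.univ.filter fun v => (dep v + j) % k = 0).card ≤
        Fintype.card V := by
      simp_rw [Finset.card_filter]
      rw [Finset.sum_comm, ← Finset.card_univ, Finset.card_eq_sum_ones]
      refine Finset.sum_le_sum fun v _ => ?_
      rw [← Finset.card_filter, Finset.card_le_one]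
      intro a ha b hb
      simp only [Finset.mem_filter, Finset.mem_range] at ha hb
      have : dep v + a ≡ dep v + b [MOD k] := ha.2.trans hb.2.symm
      exact Nat.ModEq.eq_of_lt_of_lt (Nat.ModEq.add_left_cancel' _ this) ha.1 hb.1
    have h2 := Finset.sum_lt_sum_of_nonempty (Finset.nonempty_range_iff.2 hk.ne') h
    rw [← Finset.mul_sum, Finset.sum_const, Finset.card_range, smul_eq_mul] at h2
    exact absurd h2 (not_lt.2 (Nat.mul_le_mul_left _ h1))
  obtain ⟨j, -, hj⟩ := hcut
  let t : V → ℕ := fun v => (dep v + j) % k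
  let C : Finset V := Finset.univ.filter fun v => (dep v + j) % k = 0
  -- All non-tree edges are deleted, as are the parent edges at the chosen depths. Climbing `t v`
  -- steps from `v` reaches the nearest cut vertex, or the root, where `p` is stationary.
  let Del := (F.edgeFinset \ T) ∪ C.image fun v => s(v, p v)
  refine ⟨fun v => p^[t v] v, Del, ?_, ?_, ?_⟩
  · intro v
    have : ∀ n v, F.Near n v (p^[n] v) := by
      intro n
      induction n with
      | zero => exact fun v => Near.refl F v
      | succ n ih =>
        intro v
        rw [Function.iterate_succ_apply]
        by_cases hv : dep v = 0
        · have := ih v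
          rw [← hp0 v hv] at this
          rw [hp0 v hv] at this ⊢
          exact this.mono (by omega)
        · exact ((Near.of_adj (hp v hv).1).trans (ih _)).mono (by omega)
    exact (this _ v).mono (Nat.mod_lt _ hk).le
  · have key : ∀ v, dep v ≠ 0 → t v ≠ 0 → p^[t v] v = p^[t (p v)] (p v) := by
      intro v hv ht
      have e1 := (hp v hv).2
      have e2 : t v = t (p v) + 1 := by
        simp only [t] at ht ⊢
        rw [← e1, add_right_comm] at ht ⊢
        generalize dep (p v) + j = q at ht ⊢
        have hlt := Nat.mod_lt q hk
        rw [← Nat.mod_add_mod] at ht ⊢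
        rcases Nat.lt_or_ge (q % k + 1) k with h | h
        · exact Nat.mod_eq_of_lt h
        · rw [show q % k + 1 = k by omega, Nat.mod_self] at ht
          exact absurd rfl ht
      rw [e2, Function.iterate_succ_apply]
    intro x y hxy hDel
    simp only [Del, Finset.mem_union, Finset.mem_sdiff, mem_edgeFinset, mem_edgeSet, hxy, true_and,
      not_or, not_not] at hDel
    obtain ⟨v, hv, hve⟩ := Finset.mem_image.1 hDel.1
    have ht : t v ≠ 0 := by
      intro h
      exact hDel.2 (Finset.mem_image.2 ⟨v, by simpa [C] using h, hve⟩)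
    have := key v (Finset.mem_filter.1 hv).2 ht
    rcases Sym2.eq_iff.1 hve with ⟨rfl, rfl⟩ | ⟨rfl, rfl⟩
    exacts [this, this.symm]
  · have h1 : Del.card ≤ F.edgeFinset.card - T.card + C.card := by
      refine (Finset.card_union_le _ _).trans ?_
      rw [Finset.card_sdiff_of_subset hTF]
      exact Nat.add_le_add_left Finset.card_image_le _
    have h2 := Finset.card_le_card hTF
    have h3 : F.edgeSet.ncard = F.edgeFinset.card := by
      rw [← coe_edgeFinset, Set.ncard_coe_finset]
    have h4 : Del.card + Fintype.card V ≤ F.edgeSet.ncard + Nat.card F.ConnectedComponent +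
      C.card := by omega
    have h5 := Nat.mul_le_mul_left k h4
    simp only [mul_add] at h5
    have h6 : k * C.card ≤ Fintype.card V := hj
    omega

/-- The boundary of a partition into small sets is large, if that of small sets is. -/
theorem card_small_le [Fintype V] [DecidableEq V] {ι : Type*} [Fintype ι] [DecidableEq ι]
    (G : SimpleGraph V) [DecidableRel G.Adj] {s : ℕ}
    (hIso : ∀ K : Finset V, K.card ≤ s → K.card ≤
      (Finset.univ.filter fun z : V × V => z.1 ∈ K ∧ z.2 ∉ K ∧ G.Adj z.1 z.2).card) (f : V → ι) :
    (Finset.univ.filter fun x => (Finset.univ.filter fun y => f y = f x).card ≤ s).card ≤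
      (Finset.univ.filter fun z : V × V => f z.1 ≠ f z.2 ∧ G.Adj z.1 z.2).card := by
  rw [Finset.card_eq_sum_card_fiberwise (f := f) (t := Finset.univ) (by simp),
    Finset.card_eq_sum_card_fiberwise (f := fun z : V × V => f z.1) (t := Finset.univ)
      (s := Finset.univ.filter fun z : V × V => f z.1 ≠ f z.2 ∧ G.Adj z.1 z.2) (by simp)]
  refine Finset.sum_le_sum fun w _ => ?_
  by_cases hw : (Finset.univ.filter fun y => f y = w).card ≤ s
  · calc _ ≤ (Finset.univ.filter fun y => f y = w).card := by
          apply Finset.card_le_card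
          intro x hx
          simp only [Finset.mem_filter, Finset.mem_univ, true_and] at hx ⊢
          exact hx.2
      _ ≤ _ := hIso _ hw
      _ ≤ _ := by
          apply Finset.card_le_card
          intro z hz
          simp only [Finset.mem_filter, Finset.mem_univ, true_and] at hz ⊢
          obtain ⟨h1, h2, h3⟩ := hz
          exact ⟨⟨fun h => h2 (h ▸ h1), h3⟩, h1⟩
  · rw [Finset.card_eq_zero.2]
    · exact Nat.zero_le _
    · ext x
      simp only [Finset.mem_filter, Finset.mem_univ, true_and, Finset.notMem_empty, iff_false]
      rintro ⟨h1, rfl⟩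
      exact hw h1

/-- Pairs of neighbors starting in a given set. -/
theorem card_pairs_le [Fintype V] [DecidableEq V] {G : SimpleGraph V} {D : ℕ}
    (hD : ∀ x, ∃ s : Finset V, s.card ≤ D ∧ ∀ y, G.Adj x y → y ∈ s) (S : Finset V)
    (Z : Finset (V × V)) (hZ : ∀ z ∈ Z, z.1 ∈ S ∧ G.Adj z.1 z.2) : Z.card ≤ S.card * D := by
  choose nb hnb hnb' using hD
  refine (Finset.card_le_card (t := S.biUnion fun x => (nb x).image fun y => (x, y)) ?_).trans
    (Finset.card_biUnion_le_card_mul _ _ _ fun x _ => Finset.card_image_le.trans (hnb x))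
  intro z hz
  simp only [Finset.mem_biUnion, Finset.mem_image]
  exact ⟨z.1, (hZ z hz).1, z.2, hnb' _ _ (hZ z hz).2, rfl⟩

/-- Small components have at most as many vertices in total as there are boundary pairs, and such a
pair must start in `Bad`, since `F` joins the neighbors of other vertices. Components with more than
`s` vertices number at most `|V| / s`. -/
theorem card_components_le [Fintype V] [DecidableEq V] {G F : SimpleGraph V} {D s M : ℕ}
    (hD : ∀ x, ∃ s : Finset V, s.card ≤ D ∧ ∀ y, G.Adj x y → y ∈ s) [DecidableRel G.Adj]
    (hIso : ∀ K : Finset V, K.card ≤ s → K.card ≤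
      (Finset.univ.filter fun z : V × V => z.1 ∈ K ∧ z.2 ∉ K ∧ G.Adj z.1 z.2).card)
    {Bad : Finset V} (hBad : ∀ x ∉ Bad, ∀ y, G.Adj x y → F.Near M x y) :
    s * Nat.card F.ConnectedComponent ≤ s * (Bad.card * D) + Fintype.card V := by
  classical
  let f := F.connectedComponentMk
  have h1 := card_small_le G hIso f
  have h2 := card_pairs_le hD Bad
    (Finset.univ.filter fun z : V × V => f z.1 ≠ f z.2 ∧ G.Adj z.1 z.2) (by
      intro z hz
      simp only [Finset.mem_filter, Finset.mem_univ, true_and] at hz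
      refine ⟨?_, hz.2⟩
      by_contra hB
      exact hz.1 (ConnectedComponent.sound (hBad _ hB _ hz.2).reachable))
  set P := Finset.univ.filter fun x => (Finset.univ.filter fun y => f y = f x).card ≤ s with hP
  have h3 : s * Nat.card F.ConnectedComponent ≤ s * P.card + Fintype.card V := by
    rw [Nat.card_eq_fintype_card, ← Finset.card_univ, ← Finset.card_univ (α := V), mul_comm s,
      ← smul_eq_mul, ← Finset.sum_const,
      Finset.card_eq_sum_card_fiberwise (f := f) (s := P) (t := Finset.univ) (by simp),
      Finset.card_eq_sum_card_fiberwise (f := f) (s := Finset.univ) (t := Finset.univ) (by simp),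
      Finset.mul_sum, ← Finset.sum_add_distrib]
    refine Finset.sum_le_sum fun w _ => ?_
    by_cases hw : (Finset.univ.filter fun y => f y = w).card ≤ s
    · have : 0 < (P.filter fun y => f y = w).card := by
        rw [Finset.card_pos]
        induction w using ConnectedComponent.ind with
        | _ v => exact ⟨v, by simpa [hP, f] using hw⟩
      have := Nat.le_mul_of_pos_right s this
      omega
    · omega
  have h4 := Nat.mul_le_mul_left s (h1.trans h2)
  omega

/-- The vertices are outnumbered by those close to bad vertices or to deleted edges. -/
theorem card_le_of_partition [Fintype V] [DecidableEq V] {G F : SimpleGraph V} (hFG : F ≤ G)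
    {D s M k : ℕ} (hD : ∀ x, ∃ s : Finset V, s.card ≤ D ∧ ∀ y, G.Adj x y → y ∈ s)
    [DecidableRel G.Adj]
    (hIso : ∀ K : Finset V, K.card ≤ s → K.card ≤
      (Finset.univ.filter fun z : V × V => z.1 ∈ K ∧ z.2 ∉ K ∧ G.Adj z.1 z.2).card)
    (hs : (D + 1) ^ k ≤ s)
    {Bad : Finset V} (hBad : ∀ x ∉ Bad, ∀ y, G.Adj x y → F.Near M x y)
    {rep : V → V} {Del : Finset (Sym2 V)} (hrep : ∀ v, F.Near k v (rep v))
    (hDel : ∀ x y, F.Adj x y → s(x, y) ∉ Del → rep x = rep y) :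
    Fintype.card V ≤ (Bad.card + 2 * Del.card * (D + 1) ^ M) * D := by
  classical
  have h1 := card_small_le G hIso rep
  have hball := fun L x => G.card_near_le D hD L x
  choose ball hball hball' using hball
  -- Each part lies in a ball of radius `k`, so it has at most `(D + 1) ^ k ≤ s` vertices and the
  -- boundary estimate applies to all parts.
  have hall : (Finset.univ.filter fun x => (Finset.univ.filter fun y => rep y = rep x).card ≤ s) =
      Finset.univ := by
    refine Finset.filter_true_of_mem fun x _ => ?_
    refine (Finset.card_le_card (t := ball k (rep x)) fun y hy => ?_).trans ((hball _ _).trans hs)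
    refine hball' _ _ _ ?_
    simp only [Finset.mem_filter, Finset.mem_univ, true_and] at hy
    rw [← hy]
    exact ((hrep y).mono_graph hFG).symm
  rw [hall, Finset.card_univ] at h1
  let E : Finset V := Del.biUnion fun e => e.toFinset
  have hE : E.card ≤ 2 * Del.card := by
    rw [mul_comm]
    refine Finset.card_biUnion_le_card_mul _ _ _ fun e _ => ?_
    rw [Sym2.card_toFinset]
    split_ifs <;> omega
  let S : Finset V := Bad ∪ E.biUnion (ball M)
  have hS : S.card ≤ Bad.card + 2 * Del.card * (D + 1) ^ M := by
    refine (Finset.card_union_le _ _).trans (Nat.add_le_add_left ?_ _)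
    exact (Finset.card_biUnion_le_card_mul _ _ _ fun e _ => hball M e).trans (by gcongr)
  refine (h1.trans (card_pairs_le hD S _ ?_)).trans (Nat.mul_le_mul_right _ hS)
  rintro ⟨x, y⟩ hz
  simp only [Finset.mem_filter, Finset.mem_univ, true_and] at hz
  refine ⟨?_, hz.2⟩
  by_contra hxS
  simp only [S, Finset.mem_union, not_or] at hxS
  obtain ⟨p, hp⟩ := hBad x hxS.1 y hz.2
  -- A walk in `F` between different parts uses a deleted edge, so `x` is within `M` of an end of
  -- it.
  obtain ⟨u, v, huv, hu, hv⟩ := p.exists_exit (fun z => rep x = rep z) rfl hz.1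
  have hD' : s(u, v) ∈ Del := by
    by_contra h
    exact hv (hu.trans (hDel u v (p.edges_subset_edgeSet huv) h))
  apply hxS.2
  have hus := p.fst_mem_support_of_mem_edges huv
  refine Finset.mem_biUnion.2 ⟨u, ?_, hball' M u x ?_⟩
  · refine Finset.mem_biUnion.2 ⟨_, hD', ?_⟩
    simp
  · refine (Near.mono_graph (X := F) ?_ hFG).symm
    exact ⟨p.takeUntil u hus, (p.length_takeUntil_le_length hus).trans hp⟩

variable {V' : Type*}

/-- If every edge of `X` is replaceable by a walk of length at most `K` in `Y`, then a walk of
length `L` is replaceable by one of length `L * K`. -/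
theorem Near.subst {X : SimpleGraph V} {Y : SimpleGraph V'} {f : V → V'} {K L : ℕ}
    (hf : ∀ x y, X.Adj x y → Y.Near K (f x) (f y)) {x y : V} (h : X.Near L x y) :
    Y.Near (L * K) (f x) (f y) := by
  obtain ⟨p, hp⟩ := h
  refine Near.mono (L := p.length * K) ?_ (by gcongr)
  clear hp
  induction p with
  | nil => exact (Near.refl Y _).mono (Nat.zero_le _)
  | cons h q ih =>
    refine ((hf _ _ h).trans ih).mono ?_
    rw [Walk.length_cons]
    linarith

end SimpleGraph

/-! ### Free actions and expansion of small sets -/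

section Schreier

variable {A B : Type*} {d b n : ℕ}

/-- The Schreier graph of a family of maps `s i`. -/
def schreier (s : Fin d → A → A) : SimpleGraph A where
  Adj x y := x ≠ y ∧ ((∃ i, y = s i x) ∨ ∃ i, x = s i y)
  symm := ⟨fun _ _ h => ⟨h.1.symm, h.2.symm⟩⟩
  loopless := ⟨fun _ h => h.1 rfl⟩

/-- Reduced words of length at most `n` in the maps `s i` act freely. -/
def ActsFreely (n : ℕ) (s : Fin d → A → A) : Prop :=
  ∀ a, Function.Injective fun w : RegTree d n => w.1.foldr s a

theorem schreier_adj {s : Fin d → A → A} (hs : ∀ i, Function.Involutive (s i)) {x y : A} :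
    (schreier s).Adj x y ↔ x ≠ y ∧ ∃ i, y = s i x := by
  refine and_congr_right fun _ => ⟨?_, Or.inl⟩
  rintro (h | ⟨i, rfl⟩)
  exacts [h, ⟨i, (hs i y).symm⟩]

/-- The word with the single letter `i`. -/
def RegTree.single (hn : 1 ≤ n) (i : Fin d) : RegTree d n := ⟨[i], List.isChain_singleton _, hn⟩

theorem ActsFreely.ne {s : Fin d → A → A} (h : ActsFreely n s) (hn : 1 ≤ n) (i : Fin d) (x : A) :
    s i x ≠ x := by
  intro he
  have := h x (a₁ := RegTree.single hn i) (a₂ := RegTree.root d n) he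
  exact absurd (congrArg Subtype.val this) (List.cons_ne_nil _ _)

theorem ActsFreely.injective {s : Fin d → A → A} (h : ActsFreely n s) (hn : 1 ≤ n) (x : A) :
    Function.Injective fun i => s i x := by
  intro i j he
  have := h x (a₁ := RegTree.single hn i) (a₂ := RegTree.single hn j) he
  exact (List.cons.inj (congrArg Subtype.val this)).1

/-- In a free action, every small set has an element with at most one neighbor in the set. -/
theorem ActsFreely.exists_leaf [DecidableEq A] {s : Fin d → A → A} (h : ActsFreely n s)
    {K : Finset A} (hK : K.Nonempty) (hKn : K.card ≤ n) :
    ∃ x ∈ K, (Finset.univ.filter fun i => s i x ∈ K).card ≤ 1 := by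
  by_contra! hc
  obtain ⟨a, ha⟩ := hK
  -- If each point of `K` had two neighbors in `K`, reduced words could be prolonged inside `K`
  -- forever. By freeness, the suffixes of one of length `|K|` would give `|K| + 1` distinct points
  -- of `K`.
  have key : ∀ m, ∃ w : List (Fin d), w.IsChain (fun a c => a ≠ c) ∧ w.length = m ∧
      ∀ l, (w.drop l).foldr s a ∈ K := by
    intro m
    induction m with
    | zero => exact ⟨[], List.isChain_nil, rfl, by simpa⟩
    | succ m ih =>
      obtain ⟨w, hw, hm, hwK⟩ := ih
      have hx : w.foldr s a ∈ K := by simpa using hwK 0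
      obtain ⟨i, hi, j, hj, hij⟩ := Finset.one_lt_card.1 (hc _ hx)
      have : ∃ i, s i (w.foldr s a) ∈ K ∧ w.head? ≠ some i := by
        by_cases h' : w.head? = some i
        · refine ⟨j, (Finset.mem_filter.1 hj).2, ?_⟩
          rw [h']
          simpa using hij
        · exact ⟨i, (Finset.mem_filter.1 hi).2, h'⟩
      obtain ⟨i, hi, hwi⟩ := this
      refine ⟨i :: w, ?_, by simp [hm], ?_⟩
      · cases w with
        | nil => simp
        | cons c w =>
          rw [List.isChain_cons_cons]
          refine ⟨?_, hw⟩
          rintro rfl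
          exact hwi rfl
      · rintro (_ | l)
        · simpa using hi
        · simpa using hwK l
  obtain ⟨w, hw, hm, hwK⟩ := key K.card
  have hinj : Function.Injective fun l : Fin (K.card + 1) =>
      (⟨(w.drop l).foldr s a, hwK l⟩ : K) := by
    intro l l' he
    have hlen : ∀ l : ℕ, (w.drop l).length ≤ n := fun l => by rw [List.length_drop]; omega
    have := h a (a₁ := ⟨w.drop l, hw.drop l, hlen l⟩) (a₂ := ⟨w.drop l', hw.drop l', hlen l'⟩)
      (congrArg Subtype.val he)
    have := congrArg (fun v => v.1.length) this
    simp only [List.length_drop] at this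
    ext
    omega
  have := Fintype.card_le_of_injective _ hinj
  simp at this

/-- Small sets span forests: removing a leaf destroys at most one edge, which is counted from both
ends. -/
theorem ActsFreely.card_internal_le [DecidableEq A] {s : Fin d → A → A}
    (hs : ∀ i, Function.Involutive (s i)) (h : ActsFreely n s) (K : Finset A) (hKn : K.card ≤ n) :
    ∑ x ∈ K, (Finset.univ.filter fun i => s i x ∈ K).card ≤ 2 * K.card := by
  induction hm : K.card generalizing K with
  | zero => simp [Finset.card_eq_zero.1 hm]
  | succ m ih =>
    obtain ⟨x, hx, hx1⟩ := h.exists_leaf (Finset.card_pos.1 (by omega : 0 < K.card)) hKn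
    have hcard : (K.erase x).card = m := by rw [Finset.card_erase_of_mem hx]; omega
    have ih' := ih (K.erase x) (by omega) hcard
    rw [← Finset.add_sum_erase _ _ hx]
    have h1 : ∀ y ∈ K.erase x, (Finset.univ.filter fun i => s i y ∈ K).card ≤
        (Finset.univ.filter fun i => s i y ∈ K.erase x).card +
        (Finset.univ.filter fun i => s i y = x).card := by
      intro y _
      refine (Finset.card_le_card fun i hi => ?_).trans (Finset.card_union_le _ _)
      simp only [Finset.mem_union, Finset.mem_filter, Finset.mem_univ, true_and,
        Finset.mem_erase] at hi ⊢
      tauto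
    have h2 : ∑ y ∈ K.erase x, (Finset.univ.filter fun i => s i y = x).card ≤
        (Finset.univ.filter fun i => s i x ∈ K).card := by
      simp_rw [Finset.card_filter]
      rw [Finset.sum_comm]
      refine Finset.sum_le_sum fun i _ => ?_
      rw [← Finset.card_filter]
      split_ifs with hi
      · rw [Finset.card_le_one]
        intro y hy z hz
        exact (hs i).injective ((Finset.mem_filter.1 hy).2.trans (Finset.mem_filter.1 hz).2.symm)
      · rw [Nat.le_zero, Finset.card_eq_zero, Finset.filter_eq_empty_iff]
        rintro y hy rfl
        rw [hs i y] at hi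
        exact hi (Finset.mem_of_mem_erase hy)
    have h3 := Finset.sum_le_sum h1
    rw [Finset.sum_add_distrib] at h3
    omega

/-- Small sets have large boundary. -/
theorem ActsFreely.card_le_boundary [Fintype A] [DecidableEq A] {s : Fin d → A → A}
    (hs : ∀ i, Function.Involutive (s i)) (h : ActsFreely n s) (hd : 3 ≤ d) (hn : 1 ≤ n)
    {G : SimpleGraph A} [DecidableRel G.Adj] (hG : ∀ x i, G.Adj x (s i x))
    (K : Finset A) (hKn : K.card ≤ n) :
    K.card ≤ (Finset.univ.filter fun z : A × A => z.1 ∈ K ∧ z.2 ∉ K ∧ G.Adj z.1 z.2).card := by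
  have h1 := h.card_internal_le hs K hKn
  have h2 : ∑ x ∈ K, (Finset.univ.filter fun i => s i x ∉ K).card ≤
      (Finset.univ.filter fun z : A × A => z.1 ∈ K ∧ z.2 ∉ K ∧ G.Adj z.1 z.2).card := by
    rw [← Finset.card_sigma]
    refine Finset.card_le_card_of_injOn (fun p => (p.1, s p.2 p.1)) ?_ ?_
    · rintro ⟨x, i⟩ hx
      simp only [Finset.coe_sigma, Set.mem_sigma_iff, Finset.mem_coe,
        Finset.mem_univ, true_and, Finset.coe_filter, Set.mem_ofPred_eq] at hx ⊢
      exact ⟨hx.1, hx.2, hG x i⟩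
    · rintro ⟨x, i⟩ _ ⟨y, j⟩ _ he
      obtain ⟨rfl, he⟩ := Prod.mk.inj he
      obtain rfl := h.injective hn _ he
      rfl
  -- At least `3 |K|` pairs start in `K` and at most `2 |K|` of them stay inside.
  have h3 : ∀ x ∈ K, 3 ≤ (Finset.univ.filter fun i => s i x ∈ K).card +
      (Finset.univ.filter fun i => s i x ∉ K).card := by
    intro x _
    rw [Finset.card_filter_add_card_filter_not, Finset.card_univ, Fintype.card_fin]
    exact hd
  have h4 := Finset.sum_le_sum h3
  rw [Finset.sum_add_distrib, Finset.sum_const, smul_eq_mul] at h4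
  omega

/-- The product of two Schreier graphs. -/
def schreierProd (s : Fin d → A → A) (t : Fin b → B → B) : SimpleGraph (A × B) :=
  schreier s □ schreier t

/-! ### The product graph and its sparse subgraph -/

section Product

variable {s : Fin d → A → A} {t : Fin b → B → B}

theorem schreierProd_degree [DecidableEq A] [DecidableEq B] (hs : ∀ i, Function.Involutive (s i))
    (ht : ∀ i, Function.Involutive (t i)) (x : A × B) :
    ∃ S : Finset (A × B), S.card ≤ d + b ∧ ∀ y, (schreierProd s t).Adj x y → y ∈ S := by
  refine ⟨(Finset.univ.image fun i => (s i x.1, x.2)) ∪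
    (Finset.univ.image fun i => (x.1, t i x.2)), ?_, ?_⟩
  · refine (Finset.card_union_le _ _).trans (Nat.add_le_add ?_ ?_)
    · exact Finset.card_image_le.trans (by simp)
    · exact Finset.card_image_le.trans (by simp)
  · rintro ⟨y, z⟩ h
    rw [schreierProd, boxProd_adj, schreier_adj hs, schreier_adj ht] at h
    simp only [Finset.mem_union, Finset.mem_image, Finset.mem_univ, true_and, Prod.mk.injEq]
    rcases h with ⟨⟨-, i, h⟩, h'⟩ | ⟨⟨-, i, h⟩, h'⟩
    · exact Or.inl ⟨i, h.symm, h'⟩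
    · exact Or.inr ⟨i, h', h.symm⟩

/-- The first factor acts freely on the product by itself, so its edges alone provide the expansion.
-/
theorem schreierProd_boundary [Fintype A] [Fintype B] [DecidableEq A] [DecidableEq B]
    [DecidableRel (schreierProd s t).Adj] (hs : ∀ i, Function.Involutive (s i))
    (h : ActsFreely n s) (hd : 3 ≤ d) (hn : 1 ≤ n) (K : Finset (A × B)) (hKn : K.card ≤ n) :
    K.card ≤ (Finset.univ.filter fun z : (A × B) × (A × B) =>
      z.1 ∈ K ∧ z.2 ∉ K ∧ (schreierProd s t).Adj z.1 z.2).card := by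
  let s' : Fin d → A × B → A × B := fun i z => (s i z.1, z.2)
  have hfold : ∀ (w : List (Fin d)) (z : A × B), w.foldr s' z = (w.foldr s z.1, z.2) := by
    intro w z
    induction w with
    | nil => rfl
    | cons i w ih => rw [List.foldr_cons, ih, List.foldr_cons]
  refine ActsFreely.card_le_boundary (s := s') (fun i z => ?_) ?_ hd hn ?_ K hKn
  · simp [s', hs i z.1]
  · intro z w w' he
    simp only [hfold, Prod.mk.injEq] at he
    exact h z.1 he.1
  · intro z i
    rw [schreierProd, boxProd_adj, schreier_adj hs]
    exact Or.inl ⟨⟨(h.ne hn i z.1).symm, i, rfl⟩, rfl⟩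

/-- The subgraph of the product which has all edges of colors `i₀`, `i₁` in the first factor, but
other edges only over the sparse sets `SA` and `SB`. -/
def sparseSubgraph (s : Fin d → A → A) (t : Fin b → B → B) (i₀ i₁ : Fin d) (SA : Finset A)
    (SB : Finset B) : SimpleGraph (A × B) where
  Adj x y := (schreierProd s t).Adj x y ∧
    ((x.2 = y.2 ∧ ((schreier ![s i₀, s i₁]).Adj x.1 y.1 ∨ x.2 ∈ SB)) ∨ (x.1 = y.1 ∧ x.1 ∈ SA))
  symm := ⟨fun x y ⟨h, h'⟩ => ⟨h.symm, by
    rcases h' with ⟨h1, h2⟩ | ⟨h1, h2⟩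
    · exact Or.inl ⟨h1.symm, h2.imp (fun h => h.symm) (fun h => h1 ▸ h)⟩
    · exact Or.inr ⟨h1.symm, h1 ▸ h2⟩⟩⟩
  loopless := ⟨fun x h => (schreierProd s t).loopless.irrefl x h.1⟩

theorem schreier_pair_le {i₀ i₁ : Fin d} : schreier ![s i₀, s i₁] ≤ schreier s := by
  rintro x y ⟨h, ⟨i, h'⟩ | ⟨i, h'⟩⟩
  · refine ⟨h, Or.inl ?_⟩
    fin_cases i
    exacts [⟨i₀, h'⟩, ⟨i₁, h'⟩]
  · refine ⟨h, Or.inr ?_⟩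
    fin_cases i
    exacts [⟨i₀, h'⟩, ⟨i₁, h'⟩]

/-- This is why products have cost 1. An edge of the second factor is slid along an `i₀`, `i₁` line
to a point over `SA`, at cost `2 * L + 1`. An edge of the first factor is then slid by at most `L`
such moves to `SB`, crossed there, and slid back. -/
theorem sparseSubgraph_near {i₀ i₁ : Fin d} {j₀ j₁ : Fin b} {SA : Finset A} {SB : Finset B}
    {L : ℕ} (hA : ∀ a, ∃ a' ∈ SA, (schreier ![s i₀, s i₁]).Near L a a')
    (hB : ∀ y, ∃ y' ∈ SB, (schreier ![t j₀, t j₁]).Near L y y') (x y : A × B)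
    (hxy : (schreierProd s t).Adj x y) :
    (sparseSubgraph s t i₀ i₁ SA SB).Near (2 * (L * (2 * L + 1)) + 1) x y := by
  set H := sparseSubgraph s t i₀ i₁ SA SB
  have hline : ∀ a a' y, (schreier ![s i₀, s i₁]).Near L a a' → H.Near L (a, y) (a', y) := by
    intro a a' y h
    have := Near.subst (Y := H) (f := fun a => (a, y)) (K := 1) (fun u v huv => Near.of_adj
      ⟨boxProd_adj.2 (Or.inl ⟨schreier_pair_le huv, rfl⟩), Or.inl ⟨rfl, Or.inl huv⟩⟩) h
    rwa [mul_one] at this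
  have hvert : ∀ a y y', (schreier t).Adj y y' → H.Near (2 * L + 1) (a, y) (a, y') := by
    intro a y y' h
    obtain ⟨a', ha', haa⟩ := hA a
    have h1 : H.Adj (a', y) (a', y') :=
      ⟨boxProd_adj.2 (Or.inr ⟨h, rfl⟩), Or.inr ⟨rfl, ha'⟩⟩
    exact (((hline _ _ y haa).trans (Near.of_adj h1)).trans (hline _ _ y' haa).symm).mono (by omega)
  obtain ⟨a, c⟩ := x
  obtain ⟨a', y'⟩ := y
  rcases boxProd_adj.1 hxy with ⟨h, h'⟩ | ⟨h, h'⟩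
  · obtain rfl : c = y' := h'
    obtain ⟨z, hz, hyz⟩ := hB c
    have h1 : ∀ a, H.Near (L * (2 * L + 1)) (a, c) (a, z) := fun a =>
      Near.subst (f := fun y => (a, y)) (fun u v huv => hvert a u v (schreier_pair_le huv)) hyz
    have h2 : H.Adj (a, z) (a', z) :=
      ⟨boxProd_adj.2 (Or.inl ⟨h, rfl⟩), Or.inl ⟨rfl, Or.inr hz⟩⟩
    exact (((h1 a).trans (Near.of_adj h2)).trans (h1 a').symm).mono (by omega)
  · obtain rfl : a = a' := h'
    exact (hvert a _ _ h).mono (by nlinarith)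

/-- Degree count: the two chosen involutions contribute at most 2 at every vertex, and all else is
confined to `SA` and `SB`. -/
theorem two_mul_ncard_sparseSubgraph_le [Fintype A] [Fintype B]
    (hs : ∀ i, Function.Involutive (s i))
    (ht : ∀ i, Function.Involutive (t i)) {i₀ i₁ : Fin d} {SA : Finset A} {SB : Finset B} :
    2 * (sparseSubgraph s t i₀ i₁ SA SB).edgeSet.ncard ≤ 2 * Fintype.card (A × B) +
      d * (Fintype.card A * SB.card) + b * (SA.card * Fintype.card B) := by
  classical
  set H := sparseSubgraph s t i₀ i₁ SA SB
  have h1 : H.edgeSet.ncard = H.edgeFinset.card := by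
    rw [← coe_edgeFinset, Set.ncard_coe_finset]
  rw [h1, ← sum_degrees_eq_twice_card_edges]
  have hdeg : ∀ x, H.degree x ≤ 2 + d * (if x.2 ∈ SB then 1 else 0) +
      b * (if x.1 ∈ SA then 1 else 0) := by
    rintro ⟨a, y⟩
    let N1 : Finset (A × B) := {(s i₀ a, y), (s i₁ a, y)}
    let N2 : Finset (A × B) := if y ∈ SB then Finset.univ.image fun i => (s i a, y) else ∅
    let N3 : Finset (A × B) := if a ∈ SA then Finset.univ.image fun i => (a, t i y) else ∅
    have hsub : H.neighborFinset (a, y) ⊆ N1 ∪ N2 ∪ N3 := by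
      rintro ⟨a', y'⟩ h
      rw [mem_neighborFinset] at h
      have hpair : ∀ i, Function.Involutive ((![s i₀, s i₁] : Fin 2 → A → A) i) := by
        intro i
        fin_cases i
        exacts [hs _, hs _]
      obtain ⟨h, ⟨rfl, h' | h'⟩ | ⟨rfl, h'⟩⟩ := h
      · obtain ⟨-, i, hi⟩ := (schreier_adj hpair).1 h'
        fin_cases i <;> simp_all [N1]
      · have h' : y ∈ SB := h'
        rcases boxProd_adj.1 h with ⟨h, _⟩ | ⟨h, _⟩
        · obtain ⟨-, i, hi⟩ := (schreier_adj hs).1 h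
          simp only [Finset.mem_union, N2, if_pos h', Finset.mem_image]
          exact Or.inl (Or.inr ⟨i, Finset.mem_univ _, by simp_all⟩)
        · exact absurd rfl h.ne
      · have h' : a ∈ SA := h'
        rcases boxProd_adj.1 h with ⟨h, _⟩ | ⟨h, _⟩
        · exact absurd rfl h.ne
        · obtain ⟨-, i, hi⟩ := (schreier_adj ht).1 h
          simp only [Finset.mem_union, N3, if_pos h', Finset.mem_image]
          exact Or.inr ⟨i, Finset.mem_univ _, by simp_all⟩
    rw [← card_neighborFinset_eq_degree]
    refine (Finset.card_le_card hsub).trans ((Finset.card_union_le _ _).trans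
      (Nat.add_le_add ((Finset.card_union_le _ _).trans (Nat.add_le_add ?_ ?_)) ?_))
    · exact Finset.card_le_two
    · simp only [N2]
      split_ifs
      · exact Finset.card_image_le.trans (by simp)
      · simp
    · simp only [N3]
      split_ifs
      · exact Finset.card_image_le.trans (by simp)
      · simp
  refine (Finset.sum_le_sum fun x _ => hdeg x).trans (le_of_eq ?_)
  rw [Finset.sum_add_distrib, Finset.sum_add_distrib, ← Finset.mul_sum, ← Finset.mul_sum,
    ← Finset.card_filter, ← Finset.card_filter]
  have e1 : (Finset.univ.filter fun x : A × B => x.2 ∈ SB) = Finset.univ ×ˢ SB := by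
    ext
    simp
  have e2 : (Finset.univ.filter fun x : A × B => x.1 ∈ SA) = SA ×ˢ Finset.univ := by
    ext
    simp
  rw [e1, e2, Finset.card_product, Finset.card_product]
  simp [mul_comm]

/-! ### Covering by the product of trees -/

/-- The covering map from the tree to a Schreier graph. -/
def cover (s : Fin d → A → A) (t : Fin b → B → B) (n : ℕ) (x : A × B)
    (v : RegTree d n × RegTree b n) : A × B :=
  (v.1.1.foldr s x.1, v.2.1.foldr t x.2)

theorem cover_root (x : A × B) : cover s t n x (RegTree.root d n, RegTree.root b n) = x := rfl

theorem cover_injective (hs : ActsFreely n s) (ht : ActsFreely n t) (x : A × B) :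
    Function.Injective (cover s t n x) := by
  intro v w h
  obtain ⟨h1, h2⟩ := Prod.mk.inj h
  exact Prod.ext (hs _ h1) (ht _ h2)

theorem adj_foldr (hs : ActsFreely n s) {v w : RegTree d n} (h : (RegTree.graph d n).Adj v w)
    (a : A) : (schreier s).Adj (v.1.foldr s a) (w.1.foldr s a) := by
  refine ⟨fun he => h.ne (hs a he), ?_⟩
  rcases h with ⟨i, h⟩ | ⟨i, h⟩
  · exact Or.inl ⟨i, by rw [h, List.foldr_cons]⟩
  · exact Or.inr ⟨i, by rw [h, List.foldr_cons]⟩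

theorem cover_adj (hs : ActsFreely n s) (ht : ActsFreely n t) (x : A × B)
    {v w : RegTree d n × RegTree b n} (h : (treeProd d b n).Adj v w) :
    (schreierProd s t).Adj (cover s t n x v) (cover s t n x w) := by
  rcases boxProd_adj.1 h with ⟨h1, h2⟩ | ⟨h1, h2⟩
  · exact boxProd_adj.2 (Or.inl ⟨adj_foldr hs h1 _, by simp [cover, h2]⟩)
  · exact boxProd_adj.2 (Or.inr ⟨adj_foldr ht h1 _, by simp [cover, h2]⟩)

theorem exists_foldr_eq_of_adj (hs : ∀ i, Function.Involutive (s i)) {v : RegTree d n}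
    (hv : v.1.length < n) {a q : A} (h : (schreier s).Adj (v.1.foldr s a) q) :
    ∃ w : RegTree d n, (RegTree.graph d n).Adj v w ∧ w.1.foldr s a = q ∧
      w.1.length ≤ v.1.length + 1 := by
  obtain ⟨-, i, rfl⟩ := (schreier_adj hs).1 h
  obtain ⟨l, hl, hln⟩ := v
  cases l with
  | nil => exact ⟨⟨[i], List.isChain_singleton _, hv⟩, Or.inl ⟨i, rfl⟩, rfl, by simp⟩
  | cons c l =>
    by_cases hc : i = c
    · subst hc
      refine ⟨⟨l, hl.tail, ?_⟩, Or.inr ⟨i, rfl⟩, ?_, ?_⟩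
      · simp only [List.length_cons] at hln
        omega
      · exact (hs i _).symm
      · simp only [List.length_cons]
        omega
    · refine ⟨⟨i :: c :: l, List.isChain_cons_cons.2 ⟨hc, hl⟩, ?_⟩, Or.inl ⟨i, rfl⟩, rfl, ?_⟩
      · simp only [List.length_cons] at hv ⊢
        omega
      · simp

theorem exists_cover_eq_of_adj (hs : ∀ i, Function.Involutive (s i))
    (ht : ∀ i, Function.Involutive (t i)) (x : A × B) {v : RegTree d n × RegTree b n}
    (hv1 : v.1.1.length < n) (hv2 : v.2.1.length < n) {q : A × B}
    (h : (schreierProd s t).Adj (cover s t n x v) q) :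
    ∃ w, (treeProd d b n).Adj v w ∧ cover s t n x w = q ∧ w.1.1.length ≤ v.1.1.length + 1 ∧
      w.2.1.length ≤ v.2.1.length + 1 := by
  obtain ⟨q1, q2⟩ := q
  rcases boxProd_adj.1 h with ⟨h1, h2⟩ | ⟨h1, h2⟩
  · obtain ⟨w, hw, hw', hl⟩ := exists_foldr_eq_of_adj hs hv1 h1
    exact ⟨(w, v.2), boxProd_adj.2 (Or.inl ⟨hw, rfl⟩), Prod.ext hw' h2, hl, by simp⟩
  · obtain ⟨w, hw, hw', hl⟩ := exists_foldr_eq_of_adj ht hv2 h1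
    exact ⟨(v.1, w), boxProd_adj.2 (Or.inr ⟨hw, rfl⟩), Prod.ext h2 hw', by simp, hl⟩

/-- Walks in the product of the Schreier graphs lift to the product of trees. -/
theorem exists_lift_walk (hs : ∀ i, Function.Involutive (s i))
    (ht : ∀ i, Function.Involutive (t i)) (x : A × B) {u q : A × B}
    (p : (schreierProd s t).Walk u q) (v : RegTree d n × RegTree b n)
    (hu : u = cover s t n x v) (hv1 : v.1.1.length + p.length ≤ n)
    (hv2 : v.2.1.length + p.length ≤ n) :
    ∃ (w : RegTree d n × RegTree b n) (p' : (treeProd d b n).Walk v w),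
      cover s t n x w = q ∧ p'.length = p.length ∧
      ∀ f ∈ p'.edges, f.map (cover s t n x) ∈ p.edges := by
  induction p generalizing v with
  | nil => exact ⟨v, .nil, hu.symm, rfl, by simp⟩
  | @cons u u' q h p ih =>
    rw [Walk.length_cons] at hv1 hv2
    subst hu
    obtain ⟨w, hw, rfl, hl1, hl2⟩ := exists_cover_eq_of_adj hs ht x (by omega) (by omega) h
    obtain ⟨w', p', hp', hl, he⟩ := ih w rfl (by omega) (by omega)
    refine ⟨w', .cons hw p', hp', by simp [hl], ?_⟩
    intro f hf
    rw [Walk.edges_cons, List.mem_cons] at hf ⊢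
    rcases hf with rfl | hf
    · exact Or.inl rfl
    · exact Or.inr (he f hf)

/-- Near the root, the covering map maps the local forest to the local forest. -/
theorem near_localForest_cover (hs : ∀ i, Function.Involutive (s i))
    (ht : ∀ i, Function.Involutive (t i)) (hsn : ActsFreely n s) (htn : ActsFreely n t)
    (x : A × B) {R : ℕ} {W : Sym2 (A × B) → ℝ} {W' : Sym2 (RegTree d n × RegTree b n) → ℝ}
    (hW : ∀ e ∈ (treeProd d b n).edgeSet, W' e = W (e.map (cover s t n x)))
    {v w : RegTree d n × RegTree b n} (p : ((treeProd d b n).localForest W' R).Walk v w)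
    (hv1 : v.1.1.length + p.length + R ≤ n) (hv2 : v.2.1.length + p.length + R ≤ n) :
    ((schreierProd s t).localForest W R).Near p.length (cover s t n x v) (cover s t n x w) := by
  induction p with
  | nil => exact Near.refl _ _
  | @cons u v w h p ih =>
    rw [Walk.length_cons] at hv1 hv2 ⊢
    have hl : v.1.1.length ≤ u.1.1.length + 1 ∧ v.2.1.length ≤ u.2.1.length + 1 := by
      have key : ∀ {d : ℕ} {a c : RegTree d n}, (RegTree.graph d n).Adj a c →
          c.1.length ≤ a.1.length + 1 := by
        intro d a c hac
        rcases hac with ⟨i, hi⟩ | ⟨i, hi⟩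
        · simp [hi]
        · rw [hi, List.length_cons]
          omega
      rcases boxProd_adj.1 h.1 with ⟨h1, h2⟩ | ⟨h1, h2⟩
      · exact ⟨key h1, by simp [h2]⟩
      · exact ⟨by simp [h2], key h1⟩
    have ih' := ih (by omega) (by omega)
    have hadj : ((schreierProd s t).localForest W R).Adj (cover s t n x u) (cover s t n x v) := by
      refine ⟨cover_adj hsn htn x h.1, fun q hq => ?_⟩
      -- A competing walk below, of length at most `R`, has room to lift before depth `n`, and by
      -- injectivity its lift ends at `v`. So the lift competes with the edge above, where a label
      -- at least as large is known.
      obtain ⟨w', q', hw', hl', he⟩ := exists_lift_walk hs ht x q u rfl (by omega) (by omega)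
      obtain rfl := cover_injective hsn htn x hw'
      obtain ⟨f, hf, hfW⟩ := h.2 q' (by omega)
      refine ⟨_, he f hf, ?_⟩
      rw [hW _ h.1, hW _ (q'.edges_subset_edgeSet hf)] at hfW
      exact hfW
    exact ((Near.of_adj hadj).trans ih').mono (by omega)

end Product

/-! ### Finite free actions with long cycles in two letters -/

/-- Putting the letter `i` in front of a word, or removing it, where possible. -/
def RegTree.shift (i : Fin d) (w : RegTree d n) : RegTree d n :=
  if h : w.1.head? = some i then ⟨w.1.tail, w.2.1.tail, by
      have := w.2.2
      rw [List.length_tail]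
      omega⟩
  else if h' : w.1.length < n then ⟨i :: w.1, by
      obtain ⟨l, hl, hln⟩ := w
      cases l with
      | nil => exact List.isChain_singleton _
      | cons c l =>
        refine List.isChain_cons_cons.2 ⟨?_, hl⟩
        rintro rfl
        exact h rfl, h'⟩
  else w

theorem RegTree.shift_involutive (i : Fin d) :
    Function.Involutive (RegTree.shift i : RegTree d n → RegTree d n) := by
  rintro ⟨l, hl, hln⟩
  cases l with
  | nil =>
    by_cases hn : 0 < n
    · simp [shift, hn]
      rfl
    · simp [shift, hn]
      rfl
  | cons c l =>
    by_cases hc : c = i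
    · subst hc
      have h1 : l.head? ≠ some c := by
        cases l with
        | nil => simp
        | cons e l =>
          have := (List.isChain_cons_cons.1 hl).1
          simpa using this.symm
      have h2 : l.length < n := by
        simp only [List.length_cons] at hln
        omega
      simp [shift, h1, h2]
      rfl
    · by_cases hlt : l.length + 1 < n
      · simp [shift, hc, hlt]
        rfl
      · simp [shift, hc, hlt]
        rfl

/-- The reflections `z ↦ -z` and `z ↦ 1 - z` of a cycle, for the first two letters. -/
def reflection (k : ℕ) (i : Fin d) (z : ZMod k) : ZMod k :=
  if i.1 = 0 then -z else if i.1 = 1 then 1 - z else z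

theorem reflection_involutive (k : ℕ) (i : Fin d) : Function.Involutive (reflection k i) := by
  intro z
  unfold reflection
  split_ifs <;> simp

/-- A free action on a finite set which is large scale cyclic along the first two letters. -/
def rotor (d n k : ℕ) (i : Fin d) (x : Equiv.Perm (RegTree d n) × ZMod k) :
    Equiv.Perm (RegTree d n) × ZMod k :=
  ((RegTree.shift_involutive i).toPerm _ * x.1, reflection k i x.2)

theorem rotor_involutive (k : ℕ) (i : Fin d) : Function.Involutive (rotor d n k i) := by
  rintro ⟨g, z⟩
  refine Prod.ext ?_ (reflection_involutive k i z)
  ext1 w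
  exact RegTree.shift_involutive i (g w)

/-- The shifts may fix vertices, but left multiplication by them on permutations acts freely: after
a reduced word, the image of the point that `g` sends to the root is the word itself. -/
theorem rotor_actsFreely (k : ℕ) : ActsFreely n (rotor d n k) := by
  rintro ⟨g, z⟩
  have key : ∀ (l : List (Fin d)), l.IsChain (fun a c => a ≠ c) → l.length ≤ n →
      ((l.foldr (rotor d n k) (g, z)).1 (g.symm (RegTree.root d n))).1 = l := by
    intro l
    induction l with
    | nil =>
      intro _ _
      exact congrArg Subtype.val (g.apply_symm_apply (RegTree.root d n))
    | cons c l ih =>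
      intro hl hln
      rw [List.length_cons] at hln
      have h1 := ih hl.tail (by omega)
      have h2 : l.head? ≠ some c := by
        cases l with
        | nil => simp
        | cons e l =>
          have := (List.isChain_cons_cons.1 hl).1
          simpa using this.symm
      have h3 : l.length < n := by omega
      rw [List.foldr_cons]
      generalize (l.foldr (rotor d n k) (g, z)) = y at h1
      change (RegTree.shift c (y.1 (g.symm (RegTree.root d n)))).1 = _
      generalize y.1 (g.symm (RegTree.root d n)) = u at h1
      subst h1
      simp [RegTree.shift, h2, h3]
  intro v w h
  refine Subtype.ext ?_
  rw [← key v.1 v.2.1 v.2.2, ← key w.1 w.2.1 w.2.2]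
  simp only at h
  rw [h]

theorem near_of_eq {s : Fin d → A → A} (i : Fin d) {x y : A} (h : y = s i x) :
    (schreier s).Near 1 x y := by
  by_cases hxy : x = y
  · subst hxy
    exact (Near.refl _ _).mono (by omega)
  · exact Near.of_adj ⟨hxy, Or.inl ⟨i, h⟩⟩

/-- The two reflections compose to `z ↦ z - 1`, so fewer than `k` rounds of two letters lead to `z =
0`, whatever happens to the permutation. Thus a set of density `1 / k` is within `2 * k` of every
point along the lines. -/
theorem rotor_near {k : ℕ} [NeZero k] (hd : 2 ≤ d) (x : Equiv.Perm (RegTree d n) × ZMod k) :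
    ∃ y, y.2 = 0 ∧ (schreier ![rotor d n k ⟨0, by omega⟩, rotor d n k ⟨1, by omega⟩]).Near
      (2 * k) x y := by
  have key : ∀ (m : ℕ) (g : Equiv.Perm (RegTree d n)), ∃ y, y.2 = 0 ∧
      (schreier ![rotor d n k ⟨0, by omega⟩, rotor d n k ⟨1, by omega⟩]).Near
      (2 * m) (g, (m : ZMod k)) y := by
    intro m
    induction m with
    | zero => exact fun g => ⟨(g, 0), rfl, by simpa using Near.refl _ _⟩
    | succ m ih =>
      intro g
      let x1 := rotor d n k ⟨1, by omega⟩ (g, ((m + 1 : ℕ) : ZMod k))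
      let x2 := rotor d n k ⟨0, by omega⟩ x1
      obtain ⟨y, hy, hy'⟩ := ih x2.1
      have h2 : x2 = (x2.1, (m : ZMod k)) := by
        refine Prod.ext rfl ?_
        simp [x2, x1, rotor, reflection]
      rw [← h2] at hy'
      refine ⟨y, hy, (((near_of_eq (y := x1) 1 rfl).trans
        (near_of_eq (y := x2) 0 rfl)).trans hy').mono (by omega)⟩
  obtain ⟨g, z⟩ := x
  obtain ⟨y, hy, hy'⟩ := key z.val g
  rw [ZMod.natCast_zmod_val] at hy'
  have := ZMod.val_lt z
  exact ⟨y, hy, hy'.mono (by omega)⟩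

end Schreier

/-! ### Random labels and transfer of events -/

namespace SimpleGraph

theorem localForest_congr {V : Type*} {X : SimpleGraph V} {W W' : Sym2 V → ℝ}
    (h : ∀ e ∈ X.edgeSet, ∀ f ∈ X.edgeSet, W e ≤ W f ↔ W' e ≤ W' f) (R : ℕ) :
    X.localForest W R = X.localForest W' R := by
  ext x y
  refine and_congr_right fun hxy => forall₂_congr fun p _ => exists_congr fun f =>
    and_congr_right fun hf => h _ hxy _ (p.edges_subset_edgeSet hf)

end SimpleGraph

/-- A set of labelings which depends only on the order of the labels is measurable. -/
theorem measurableSet_of_order {ι : Type*} [Finite ι] {S : Set (ι → ℝ)}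
    (hS : ∀ u u' : ι → ℝ, (∀ i j, u i ≤ u j ↔ u' i ≤ u' j) → u ∈ S → u' ∈ S) :
    MeasurableSet S := by
  let φ : (ι → ℝ) → ι → ι → Prop := fun u i j => u i ≤ u j
  have hφ : Measurable φ := by
    refine measurable_pi_lambda _ fun i => measurable_pi_lambda _ fun j => ?_
    exact measurableSet_setOfPred.1 (measurableSet_le (measurable_pi_apply i) (measurable_pi_apply j))
  -- `S` is a union of fibers of a measurable map to the finite set of relations on `ι`.
  have : S = φ ⁻¹' (φ '' S) := by
    refine Set.Subset.antisymm (Set.subset_preimage_image _ _) ?_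
    rintro u' ⟨u, hu, he⟩
    exact hS u u' (fun i j => iff_of_eq (congrFun (congrFun he i) j)) hu
  rw [this]
  exact hφ (Set.toFinite _).measurableSet

/-- The uniform distribution on the unit interval. -/
noncomputable abbrev unif : Measure ℝ := volume.restrict (Set.Icc (0 : ℝ) 1)

instance : IsProbabilityMeasure unif := ⟨by simp⟩

theorem ae_injective_pi_unif (ι : Type*) [Fintype ι] :
    Measure.pi (fun _ : ι => unif) {W | ¬ Function.Injective W} = 0 := by
  have h : {W : ι → ℝ | ¬ Function.Injective W} ⊆ ⋃ i, ⋃ j, {W | i ≠ j ∧ W i = W j} := by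
    intro W hW
    simp only [Function.Injective, Set.mem_ofPred_eq] at hW
    push Not at hW
    obtain ⟨i, j, h1, h2⟩ := hW
    simp only [Set.mem_iUnion]
    exact ⟨i, j, h2, h1⟩
  refine measure_mono_null h (measure_iUnion_null fun i => measure_iUnion_null fun j => ?_)
  by_cases hij : i = j
  · simp [hij]
  have hle : Measure.pi (fun _ : ι => unif) ≤ volume := by
    rw [← Measure.restrict_pi_pi]
    exact Measure.restrict_le_self
  let l : (ι → ℝ) →ₗ[ℝ] ℝ := LinearMap.proj (R := ℝ) (φ := fun _ : ι => ℝ) i -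
    LinearMap.proj (R := ℝ) (φ := fun _ : ι => ℝ) j
  refine measure_mono_null (t := (l.ker : Set (ι → ℝ))) ?_ (le_antisymm ((hle _).trans ?_) zero_le)
  · rintro W ⟨-, hW⟩
    simp [l, hW]
  · rw [Measure.addHaar_submodule]
    intro htop
    classical
    have : (Pi.single i 1 : ι → ℝ) ∈ l.ker := by rw [htop]; trivial
    simp [l, Ne.symm hij] at this

/-- The joint law of i.i.d. uniform labels. -/
theorem map_eq_pi_unif {Ω ι : Type*} [MeasurableSpace Ω] [Fintype ι] {P : Measure Ω}
    [IsProbabilityMeasure P] {U : ι → Ω → ℝ} (hU : ∀ e, HasLaw (U e) unif P)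
    (hi : iIndepFun U P) : P.map (fun ω e => U e ω) = Measure.pi fun _ : ι => unif := by
  rw [(iIndepFun_iff_map_fun_eq_pi_map fun e => (hU e).aemeasurable).1 hi]
  congr 1
  funext e
  exact (hU e).map_eq

theorem map_comp_pi_unif {ι κ : Type*} [Fintype ι] [Fintype κ] {g : ι → κ}
    (hg : Function.Injective g) :
    (Measure.pi fun _ : κ => unif).map (fun W e => W (g e)) = Measure.pi fun _ : ι => unif := by
  refine map_eq_pi_unif (U := fun e (W : κ → ℝ) => W (g e)) (fun e => ?_) ?_
  · exact ⟨(measurable_pi_apply _).aemeasurable,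
      (measurePreserving_eval (fun _ : κ => unif) (g e)).map_eq⟩
  · exact (iIndepFun_pi (μ := fun _ : κ => unif) (X := fun _ => id)
      fun _ => aemeasurable_id).precomp hg

/-- Two families of unlikely events can be made rare simultaneously. -/
theorem exists_card_le {Ω V : Type*} [MeasurableSpace Ω] [Fintype V] (μ : Measure Ω)
    [IsProbabilityMeasure μ] {E₁ E₂ : V → Set Ω} (h₁ : ∀ x, MeasurableSet (E₁ x))
    (h₂ : ∀ x, MeasurableSet (E₂ x)) {δ₁ δ₂ : ℝ} (hδ₁ : 0 < δ₁) (hδ₂ : 0 < δ₂)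
    (hE₁ : ∀ x, μ (E₁ x) ≤ ENNReal.ofReal δ₁) (hE₂ : ∀ x, μ (E₂ x) ≤ ENNReal.ofReal δ₂)
    {N : Set Ω} (hN : μ N = 0) :
    ∃ ω ∉ N, ∃ B₁ B₂ : Finset V, (∀ x, x ∈ B₁ ↔ ω ∈ E₁ x) ∧ (∀ x, x ∈ B₂ ↔ ω ∈ E₂ x) ∧
      (B₁.card : ℝ) ≤ 2 * δ₁ * Fintype.card V ∧ (B₂.card : ℝ) ≤ 2 * δ₂ * Fintype.card V := by
  classical
  -- The weights give each of the two counts mean at most `|V|`, so one outcome with `g ≤ 2 |V|`,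
  -- taken outside `N`, bounds both at once.
  let g : Ω → ℝ := fun ω => ∑ x, ((E₁ x).indicator (fun _ => δ₁⁻¹) ω +
    (E₂ x).indicator (fun _ => δ₂⁻¹) ω)
  have hi : ∀ (E : Set Ω) (c : ℝ), MeasurableSet E → Integrable (E.indicator fun _ => c) μ :=
    fun E c hE => (integrable_const c).indicator hE
  have hadd : ∀ x, Integrable (fun ω => (E₁ x).indicator (fun _ => δ₁⁻¹) ω +
      (E₂ x).indicator (fun _ => δ₂⁻¹) ω) μ := fun x => (hi _ _ (h₁ x)).add (hi _ _ (h₂ x))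
  have hint : Integrable g μ := integrable_finsetSum _ fun x _ => hadd x
  have hle : ∀ (E : Set Ω) (δ : ℝ), 0 < δ → MeasurableSet E → μ E ≤ ENNReal.ofReal δ →
      ∫ ω, E.indicator (fun _ => δ⁻¹) ω ∂μ ≤ 1 := by
    intro E δ hδ hE h
    rw [integral_indicator_const _ hE, smul_eq_mul]
    have : μ.real E ≤ δ := ENNReal.toReal_le_of_le_ofReal hδ.le h
    calc μ.real E * δ⁻¹ ≤ δ * δ⁻¹ := by gcongr
      _ = 1 := mul_inv_cancel₀ hδ.ne'
  have hg : ∫ ω, g ω ∂μ ≤ 2 * Fintype.card V := by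
    rw [integral_finsetSum _ fun x _ => hadd x]
    calc _ ≤ ∑ _x : V, (2 : ℝ) := by
          refine Finset.sum_le_sum fun x _ => ?_
          rw [integral_add (hi _ _ (h₁ x)) (hi _ _ (h₂ x))]
          linarith [hle _ _ hδ₁ (h₁ x) (hE₁ x), hle _ _ hδ₂ (h₂ x) (hE₂ x)]
      _ = _ := by simp [mul_comm]
  obtain ⟨ω, hω, hgω⟩ := exists_notMem_null_le_integral hint hN
  have hsum : ∀ (E : V → Set Ω) (c : ℝ), ∑ x, (E x).indicator (fun _ => c) ω =
      (Finset.univ.filter fun x => ω ∈ E x).card * c := by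
    intro E c
    simp [Set.indicator_apply, Finset.sum_ite]
  have hgω' : (Finset.univ.filter fun x => ω ∈ E₁ x).card * δ₁⁻¹ +
      (Finset.univ.filter fun x => ω ∈ E₂ x).card * δ₂⁻¹ ≤ 2 * (Fintype.card V : ℝ) := by
    rw [← hsum, ← hsum, ← Finset.sum_add_distrib]
    exact hgω.trans hg
  refine ⟨ω, hω, Finset.univ.filter fun x => ω ∈ E₁ x, Finset.univ.filter fun x => ω ∈ E₂ x,
    by simp, by simp, ?_, ?_⟩
  · have h0 : 0 ≤ ((Finset.univ.filter fun x => ω ∈ E₂ x).card : ℝ) * δ₂⁻¹ := by positivity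
    have h1 : ((Finset.univ.filter fun x => ω ∈ E₁ x).card : ℝ) * δ₁⁻¹ ≤ 2 * Fintype.card V := by
      linarith
    rw [← div_eq_mul_inv, div_le_iff₀ hδ₁] at h1
    linarith
  · have h0 : 0 ≤ ((Finset.univ.filter fun x => ω ∈ E₁ x).card : ℝ) * δ₁⁻¹ := by positivity
    have h1 : ((Finset.univ.filter fun x => ω ∈ E₂ x).card : ℝ) * δ₂⁻¹ ≤ 2 * Fintype.card V := by
      linarith
    rw [← div_eq_mul_inv, div_le_iff₀ hδ₂] at h1
    linarith

noncomputable instance (d b n : ℕ) : Fintype (treeProd d b n).edgeSet := Fintype.ofFinite _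

/-- The labelings of the product of trees for which the root is joined to all its neighbors by
short walks in the local forest. -/
def goodLabels (d b n M R : ℕ) : Set ((treeProd d b n).edgeSet → ℝ) :=
  {u | ∀ v, (treeProd d b n).Adj (RegTree.root d n, RegTree.root b n) v →
    ((treeProd d b n).localForest (Function.extend Subtype.val u 0) R).Near M
      (RegTree.root d n, RegTree.root b n) v}

theorem measurableSet_goodLabels (d b n M R : ℕ) : MeasurableSet (goodLabels d b n M R) := by
  refine measurableSet_of_order fun u u' h hu v hv => ?_
  rw [← localForest_congr (W := Function.extend Subtype.val u 0)]
  · exact hu v hv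
  · intro e he f hf
    have key : ∀ (w : (treeProd d b n).edgeSet → ℝ) (e) (he : e ∈ (treeProd d b n).edgeSet),
        Function.extend Subtype.val w 0 e = w ⟨e, he⟩ := fun w e he =>
      Subtype.val_injective.extend_apply w 0 ⟨e, he⟩
    rw [key _ _ he, key _ _ hf, key _ _ he, key _ _ hf]
    exact h _ _

/-- If the root has small distance to its neighbors in the minimal spanning tree, then also in the
local forest. -/
theorem mem_goodLabels {d b n M : ℕ} {u : (treeProd d b n).edgeSet → ℝ}
    {Γ : SimpleGraph (RegTree d n × RegTree b n)} (hΓ : IsMinSpanningTree (treeProd d b n) u Γ)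
    (hM : neighborDistSum (treeProd d b n) Γ (RegTree.root d n, RegTree.root b n) ≤ M) (R : ℕ) :
    u ∈ goodLabels d b n M R := by
  classical
  intro v hv
  obtain ⟨p, hp⟩ := hΓ.1.2.connected.exists_walk_length_eq_dist
    (RegTree.root d n, RegTree.root b n) v
  refine Near.mono_graph (X := Γ) ⟨p, ?_⟩ (hΓ.le_localForest (fun e =>
    (Subtype.val_injective.extend_apply u 0 e).symm) R)
  rw [hp]
  refine le_trans ?_ hM
  unfold neighborDistSum
  exact Finset.single_le_sum (f := fun v => Γ.dist (RegTree.root d n, RegTree.root b n) v)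
    (fun _ _ => Nat.zero_le _) (Finset.mem_filter.2 ⟨Finset.mem_univ _, hv⟩)

/-- This replaces `Γ` by an event on the labels alone. The event about `Γ` need not be measurable,
as it is almost surely contained in a measurable one; and `M` does not depend on `R`. -/
theorem pi_unif_goodLabels_compl_le {d b n M : ℕ} {Ω : Type*} [MeasurableSpace Ω] {P : Measure Ω}
    [IsProbabilityMeasure P] {U : (treeProd d b n).edgeSet → Ω → ℝ}
    (hU : ∀ e, HasLaw (U e) unif P) (hi : iIndepFun U P)
    {Γ : Ω → SimpleGraph (RegTree d n × RegTree b n)}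
    (hΓ : ∀ᵐ ω ∂P, IsMinSpanningTree (treeProd d b n) (fun e => U e ω) (Γ ω)) {δ : ENNReal}
    (hP : 1 - δ ≤ P {ω | neighborDistSum (treeProd d b n) (Γ ω)
      (RegTree.root d n, RegTree.root b n) ≤ M}) (R : ℕ) :
    Measure.pi (fun _ => unif) (goodLabels d b n M R)ᶜ ≤ δ := by
  have hle : 1 - δ ≤ Measure.pi (fun _ => unif) (goodLabels d b n M R) := by
    rw [← map_eq_pi_unif hU hi, Measure.map_apply_of_aemeasurable
      (aemeasurable_pi_lambda _ fun e => (hU e).aemeasurable) (measurableSet_goodLabels ..)]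
    refine hP.trans (measure_mono_ae ?_)
    filter_upwards [hΓ] with ω hω h
    exact mem_goodLabels hω h R
  rw [prob_compl_eq_one_sub (measurableSet_goodLabels ..)]
  exact tsub_le_iff_tsub_le.1 hle

section Cover

variable {A B : Type*} {d b n : ℕ}

/-- The labelings for which `x` is not joined to all its neighbors by short walks in the local
forest. -/
def badLabels {V : Type*} (X : SimpleGraph V) (M R : ℕ) (x : V) : Set (Sym2 V → ℝ) :=
  {W | ¬ ∀ y, X.Adj x y → (X.localForest W R).Near M x y}

theorem measurableSet_badLabels {V : Type*} [Finite V] (X : SimpleGraph V) (M R : ℕ) (x : V) :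
    MeasurableSet (badLabels X M R x) := by
  have : Finite (Sym2 V) := Quot.finite _
  refine measurableSet_of_order fun u u' h hu => ?_
  simp only [badLabels, Set.mem_ofPred_eq] at hu ⊢
  rwa [← localForest_congr (W := u) fun e _ f _ => h e f]

/-- Labels pulled back along the injective covering map at `x` are again i.i.d. uniform. Depth `M +
R` accommodates a walk of length `M` with all its competitors, and the extra 1 makes `n` positive,
so that the neighbors of `x` lift. -/
theorem pi_unif_badLabels_le [Fintype A] [Fintype B] [DecidableEq A] [DecidableEq B]
    {s : Fin d → A → A} {t : Fin b → B → B}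
    (hs : ∀ i, Function.Involutive (s i)) (ht : ∀ i, Function.Involutive (t i))
    (hsn : ActsFreely n s) (htn : ActsFreely n t) {M R : ℕ} (hn : M + R + 1 ≤ n) (x : A × B) :
    Measure.pi (fun _ => unif) (badLabels (schreierProd s t) M R x) ≤
      Measure.pi (fun _ => unif) (goodLabels d b n M R)ᶜ := by
  have hinj : Function.Injective fun e : (treeProd d b n).edgeSet => e.1.map (cover s t n x) :=
    (Sym2.map.injective (cover_injective hsn htn x)).comp Subtype.val_injective
  rw [← map_comp_pi_unif hinj, Measure.map_apply
    (measurable_pi_lambda _ fun e => measurable_pi_apply _) (measurableSet_goodLabels ..).compl]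
  refine measure_mono fun W hW hgood => hW fun y hy => ?_
  obtain ⟨v, hv, rfl, -⟩ := exists_cover_eq_of_adj hs ht x (n := n)
    (v := (RegTree.root d n, RegTree.root b n)) (by simp [RegTree.root]; omega)
    (by simp [RegTree.root]; omega) hy
  obtain ⟨p, hp⟩ := hgood v hv
  have hW' : ∀ e ∈ (treeProd d b n).edgeSet, Function.extend Subtype.val
      (fun e : (treeProd d b n).edgeSet => W (e.1.map (cover s t n x))) (0 : Sym2 (RegTree d n × RegTree b n) → ℝ) e =
      W (e.map (cover s t n x)) := fun e he =>
    Subtype.val_injective.extend_apply _ _ ⟨e, he⟩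
  have hlen : 0 + p.length + R ≤ n := by omega
  have := near_localForest_cover hs ht hsn htn x hW' p hlen hlen
  rw [cover_root] at this
  exact this.mono hp

end Cover

/-! ### Choice of constants and the contradiction -/

/-- The counting inequalities for a locally treelike spanning structure of the product graph are
contradictory. -/
theorem false_of_counts {N β₁ β₂ Δ B₁ B₂ D k k₂ s c EF EH : ℕ} (hN : 0 < N) (hD : 0 < D)
    (hB₁ : 0 < B₁) (hB₂ : 0 < B₂) (hk : k = 16 * B₁ * D * D) (hk₂ : k₂ = 16 * B₁ * D) (hs : k₂ ≤ s)
    (hβ₁ : (β₁ : ℝ) ≤ 2 * (1 / (8 * D)) * N)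
    (hβ₂ : (β₂ : ℝ) ≤ 2 * (1 / (64 * B₁ * D * B₂ * D)) * N)
    (ha : N ≤ (β₁ + 2 * Δ * B₁) * D) (hb : k₂ * Δ + k₂ * N ≤ k₂ * EF + k₂ * c + N)
    (hc : EF ≤ EH + β₂ * (B₂ * D)) (hd : s * c ≤ s * (β₂ * D) + N)
    (he : 2 * (k * EH) ≤ 2 * (k * N) + D * N) : False := by
  have hN' : (0 : ℝ) < N := by exact_mod_cast hN
  have hD' : (1 : ℝ) ≤ D := by exact_mod_cast hD
  have hB₁' : (1 : ℝ) ≤ B₁ := by exact_mod_cast hB₁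
  have hB₂' : (1 : ℝ) ≤ B₂ := by exact_mod_cast hB₂
  have hs' : (k₂ : ℝ) ≤ s := by exact_mod_cast hs
  have hk₂' : (k₂ : ℝ) = 16 * (B₁ * D) := by rw [hk₂]; push_cast; ring
  have hk' : (k : ℝ) = 16 * (B₁ * D) * D := by rw [hk]; push_cast; ring
  set Q : ℝ := B₁ * D with hQ
  have hQ1 : 0 < Q := by positivity
  have ha' : (N : ℝ) ≤ (β₁ + 2 * Δ * B₁) * D := by exact_mod_cast ha
  have hb' : (k₂ * Δ + k₂ * N : ℝ) ≤ k₂ * EF + k₂ * c + N := by exact_mod_cast hb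
  have hc' : (EF : ℝ) ≤ EH + β₂ * (B₂ * D) := by exact_mod_cast hc
  have hd' : (s * c : ℝ) ≤ s * (β₂ * D) + N := by exact_mod_cast hd
  have he' : (2 * (k * EH) : ℝ) ≤ 2 * (k * N) + D * N := by exact_mod_cast he
  have hβ₁D : (β₁ : ℝ) * D ≤ N / 4 := by
    calc (β₁ : ℝ) * D ≤ 2 * (1 / (8 * D)) * N * D := by gcongr
      _ = N / 4 := by field_simp; norm_num
  have hβ₂D : (β₂ : ℝ) * (B₂ * D) ≤ N / (32 * Q) := by
    calc (β₂ : ℝ) * (B₂ * D) ≤ 2 * (1 / (64 * B₁ * D * B₂ * D)) * N * (B₂ * D) := by gcongr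
      _ = N / (32 * Q) := by rw [hQ]; field_simp; norm_num
  have hβ₂' : (β₂ : ℝ) * D ≤ N / (32 * Q) := by
    refine le_trans ?_ hβ₂D
    gcongr
    nlinarith
  -- Expansion forces many deletions: bad vertices account for at most `N / 4`, so `2 * Δ * Q ≥ 3 /
  -- 4 * N`.
  have hΔ : 3 / 8 * (N / Q) ≤ Δ := by
    rw [← mul_div_assoc, div_le_iff₀ hQ1]
    nlinarith
  have hcc : (c : ℝ) ≤ N / (32 * Q) + N / (16 * Q) := by
    have hs0 : (0 : ℝ) < s := by linarith
    have h1 : (c : ℝ) ≤ β₂ * D + N / s := by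
      rw [← sub_le_iff_le_add', le_div_iff₀ hs0]
      linarith
    have h2 : (N : ℝ) / s ≤ N / (16 * Q) := by gcongr; linarith
    linarith
  have hEH : (EH : ℝ) ≤ N + N / (32 * Q) := by
    have hk0 : (0 : ℝ) < k := by rw [hk']; positivity
    have h1 : (EH : ℝ) ≤ N + D * N / (2 * k) := by
      rw [← sub_le_iff_le_add', le_div_iff₀ (by positivity)]
      linarith
    have h2 : D * N / (2 * k) = (N : ℝ) / (32 * Q) := by
      rw [hk']
      field_simp
      norm_num
    linarith
  have hΔ' : (Δ : ℝ) + N ≤ EF + c + N / (16 * Q) := by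
    have hk0 : (0 : ℝ) < k₂ := by rw [hk₂']; positivity
    rw [← hk₂', ← sub_le_iff_le_add', le_div_iff₀ hk0]
    linarith
  -- In units of `N / Q`, the upper bound for `Δ` is `1/32 + 1/32` from the excess edges of `F`,
  -- `3/32` from components and `2/32` from cuts. The sum `7/32` is below `3/8`.
  have e1 : (N : ℝ) / (32 * Q) = 1 / 32 * (N / Q) := by field_simp
  have e2 : (N : ℝ) / (16 * Q) = 1 / 16 * (N / Q) := by field_simp
  have h0 : 0 < (N : ℝ) / Q := by positivity
  rw [e1] at hβ₂D hEH hcc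
  rw [e2] at hcc hΔ'
  linarith

theorem chain_localForest_eq_zero {V : Type*} {X : SimpleGraph V} {W : Sym2 V → ℝ}
    (hW : Function.Injective W) {R : ℕ} {x : V} (p : (X.localForest W R).Walk x x)
    (hp : p.length ≤ R + 1) : p.chain = 0 := by
  classical
  funext e
  rw [Walk.chain, Pi.zero_apply, ZMod.natCast_eq_zero_iff_even]
  exact even_count_edges_localForest X hW R p hp e

/-- It is impossible that the labels, with probability close to `1` and for all sizes, join the root
to its neighbors by bounded walks in the local forest. -/
theorem not_forall_goodLabels {d b : ℕ} (hd : 3 ≤ d) (hb : 2 ≤ b) :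
    ¬ ∀ δ : ℝ, 0 < δ → ∃ M : ℕ, ∀ n, 1 ≤ n → ∀ R,
      Measure.pi (fun _ => unif) (goodLabels d b n M R)ᶜ ≤ ENNReal.ofReal δ := by
  classical
  intro h
  set D := d + b with hD
  have hD0 : (0 : ℝ) < D := by
    have : 0 < D := by omega
    exact_mod_cast this
  -- The order of choices avoids circularity. The crude scale `M₁` serves the boundary estimate and
  -- fixes the allowed number of deletions, hence `k₂`, `k` and `K`. The second scale `M₂`, with bad
  -- density small compared with these, serves the edge and component counts. `R` comes after both,
  -- which is why uniformity in `R` is required.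
  obtain ⟨M₁, hM₁⟩ := h (1 / (8 * D)) (by positivity)
  set B₁ := (D + 1) ^ M₁ with hB₁
  have hB₁0 : 0 < B₁ := by positivity
  set k := 16 * B₁ * D * D with hk
  set k₂ := 16 * B₁ * D with hk₂
  have hk0 : 0 < k := by positivity
  have hk₂0 : 0 < k₂ := by positivity
  have : NeZero k := ⟨hk0.ne'⟩
  set K := 2 * (2 * k * (2 * (2 * k) + 1)) + 1 with hK
  set B₂ := (D + 1) ^ K with hB₂
  have hB₂0 : 0 < B₂ := by positivity
  obtain ⟨M₂, hM₂⟩ := h (1 / (64 * B₁ * D * B₂ * D)) (by positivity)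
  set R := K * M₂ with hR
  set s := (D + 1) ^ k₂ with hs
  -- Large enough for sets of size `s` to expand and for both scales to fit into the covering trees.
  set n := s + M₁ + M₂ + R + 1 with hn
  have hn1 : 1 ≤ n := by omega
  let A := Equiv.Perm (RegTree d n) × ZMod k
  let B := Equiv.Perm (RegTree b n) × ZMod k
  let σ : Fin d → A → A := rotor d n k
  let τ : Fin b → B → B := rotor b n k
  have hσ : ∀ i, Function.Involutive (σ i) := rotor_involutive k
  have hτ : ∀ i, Function.Involutive (τ i) := rotor_involutive k
  have hσn : ActsFreely n σ := rotor_actsFreely k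
  have hτn : ActsFreely n τ := rotor_actsFreely k
  let G := schreierProd σ τ
  have : Fintype (ZMod k) := ZMod.fintype k
  obtain ⟨W, hW, Bad₁, Bad₂, hBad₁, hBad₂, hc₁, hc₂⟩ := exists_card_le
    (Measure.pi fun _ : Sym2 (A × B) => unif)
    (fun x => measurableSet_badLabels G M₁ R x) (fun x => measurableSet_badLabels G M₂ R x)
    (δ₁ := 1 / (8 * D)) (δ₂ := 1 / (64 * B₁ * D * B₂ * D)) (by positivity) (by positivity)
    (fun x => (pi_unif_badLabels_le hσ hτ hσn hτn (by omega) x).trans (hM₁ n hn1 R))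
    (fun x => (pi_unif_badLabels_le hσ hτ hσn hτn (by omega) x).trans (hM₂ n hn1 R))
    (ae_injective_pi_unif (Sym2 (A × B)))
  have hWinj : Function.Injective W := by simpa using hW
  have hgood : ∀ {M : ℕ} {Bad : Finset (A × B)}, (∀ x, x ∈ Bad ↔ W ∈ badLabels G M R x) →
      ∀ x ∉ Bad, ∀ y, G.Adj x y → (G.localForest W R).Near M x y := by
    intro M Bad hBad x hx
    rw [hBad] at hx
    simpa [badLabels] using hx
  let SA : Finset A := Finset.univ ×ˢ {0}
  let SB : Finset B := Finset.univ ×ˢ {0}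
  let H := sparseSubgraph σ τ ⟨0, by omega⟩ ⟨1, by omega⟩ SA SB
  have hdeg : ∀ x, ∃ S : Finset (A × B), S.card ≤ D ∧ ∀ y, G.Adj x y → y ∈ S :=
    schreierProd_degree hσ hτ
  have hHnear : ∀ x y, G.Adj x y → H.Near K x y := by
    refine sparseSubgraph_near (j₀ := ⟨0, by omega⟩) (j₁ := ⟨1, by omega⟩) ?_ ?_
    · intro a
      obtain ⟨y, hy, hy'⟩ := rotor_near (by omega : 2 ≤ d) a
      exact ⟨y, Finset.mem_product.2 ⟨Finset.mem_univ _, Finset.mem_singleton.2 hy⟩, hy'⟩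
    · intro a
      obtain ⟨y, hy, hy'⟩ := rotor_near hb a
      exact ⟨y, Finset.mem_product.2 ⟨Finset.mem_univ _, Finset.mem_singleton.2 hy⟩, hy'⟩
  have hEF := ncard_edgeSet_le (F := G.localForest W R) (H := H) (localForest_le ..)
    (fun _ _ h => h.1) hdeg (fun x p hp => chain_localForest_eq_zero hWinj p hp) (hgood hBad₂)
    hHnear le_rfl
  obtain ⟨rep, Del, hrep, hDel, hcount⟩ := exists_partition (G.localForest W R) hk₂0
  have hIso : ∀ S : Finset (A × B), S.card ≤ s → S.card ≤ (Finset.univ.filter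
      fun z : (A × B) × (A × B) => z.1 ∈ S ∧ z.2 ∉ S ∧ G.Adj z.1 z.2).card := by
    intro S hS
    convert schreierProd_boundary (t := τ) hσ hσn hd hn1 S (by omega)
  have hN := card_le_of_partition (localForest_le ..) (s := s) hdeg (by convert hIso) hs.ge (hgood hBad₁) hrep hDel
  have hcomp := card_components_le (s := s) hdeg (by convert hIso) (hgood hBad₂)
  have hEH := two_mul_ncard_sparseSubgraph_le hσ hτ (i₀ := ⟨0, by omega⟩) (i₁ := ⟨1, by omega⟩)
    (SA := SA) (SB := SB)
  have hSA : k * SA.card = Fintype.card A := by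
    simp [SA, A, ZMod.card, mul_comm]
  have hSB : k * SB.card = Fintype.card B := by
    simp [SB, B, ZMod.card, mul_comm]
  refine false_of_counts (N := Fintype.card (A × B)) (D := D) Fintype.card_pos (by omega) hB₁0 hB₂0
    hk hk₂ (Nat.lt_pow_self (by omega)).le hc₁ hc₂ hN hcount hEF hcomp (EH := H.edgeSet.ncard) ?_
  have := Nat.mul_le_mul_left k hEH
  calc 2 * (k * H.edgeSet.ncard) = k * (2 * H.edgeSet.ncard) := by ring
    _ ≤ _ := this
    _ = 2 * (k * Fintype.card (A × B)) + (d * (Fintype.card A * (k * SB.card)) +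
        b * ((k * SA.card) * Fintype.card B)) := by ring
    _ = _ := by
      rw [hSA, hSB, ← Fintype.card_prod, ← add_mul]

/-- For every `n ≥ 1`, `U n` is a family of i.i.d. uniform labels on the edges of `T_d(n) × T_b(n)`
and `Γ n` is the corresponding minimal spanning tree. -/
theorem corollary2p2 (d b : ℕ) (hd : 3 ≤ d) (hb : 2 ≤ b)
    {Ω : ℕ → Type*} [∀ n, MeasurableSpace (Ω n)]
    (P : ∀ n, Measure (Ω n)) [∀ n, IsProbabilityMeasure (P n)]
    (U : ∀ n, (treeProd d b n).edgeSet → Ω n → ℝ)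
    (hU_law : ∀ n, 1 ≤ n → ∀ e, HasLaw (U n e) (volume.restrict (Set.Icc (0 : ℝ) 1)) (P n))
    (hU_indep : ∀ n, 1 ≤ n → iIndepFun (U n) (P n))
    (Γ : ∀ n, Ω n → SimpleGraph (RegTree d n × RegTree b n))
    (hΓ : ∀ n, 1 ≤ n → ∀ᵐ ω ∂(P n),
      IsMinSpanningTree (treeProd d b n) (fun e => U n e ω) (Γ n ω)) :
    (⨆ (M : ℝ) (_ : 1 < M), ⨅ (n : ℕ) (_ : 1 ≤ n),
      P n {ω | (neighborDistSum (treeProd d b n) (Γ n ω)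
        (RegTree.root d n, RegTree.root b n) : ℝ) ≤ M}) < 1 := by
  by_contra hlt
  refine not_forall_goodLabels hd hb fun δ hδ => ?_
  -- If the supremum is not below 1, it exceeds `1 - δ`, so a single `M` serves all `n`.
  have h1 : 1 - ENNReal.ofReal δ < ⨆ (M : ℝ) (_ : 1 < M), ⨅ (n : ℕ) (_ : 1 ≤ n),
      P n {ω | (neighborDistSum (treeProd d b n) (Γ n ω)
        (RegTree.root d n, RegTree.root b n) : ℝ) ≤ M} :=
    (ENNReal.sub_lt_self ENNReal.one_ne_top one_ne_zero (ENNReal.ofReal_pos.2 hδ).ne').trans_le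
      (not_lt.1 hlt)
  obtain ⟨M, hM⟩ := lt_iSup_iff.1 h1
  obtain ⟨hM1, hM⟩ := lt_iSup_iff.1 hM
  refine ⟨⌊M⌋₊, fun n hn R => pi_unif_goodLabels_compl_le (hU_law n hn) (hU_indep n hn)
    (hΓ n hn) ?_ R⟩
  refine (hM.le.trans (iInf₂_le n hn)).trans (measure_mono fun ω hω => ?_)
  exact Nat.le_floor hω
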